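/- Let $p$ be an odd prime, let $n=2(p-1)$ and let $k\in\{0,1,\dots,p-1\}$. Let $\Gamma=R_k\vee\Theta_{p-1}\vee R_{p-1-k}$ be the graph with two vertices, the basepoint $*$ and another vertex $v$, and with $p$ edges from $*$ to $v$ (forming $\Theta_{p-1}$), $k$ loops at $*$ (forming the rose $R_k$) and $p-1-k$ loops at $v$ (forming the rose $R_{p-1-k}$). Then $\pi_1(\Gamma,*)\cong F_n$, the free group of rank $n$. Let $\mathbb{Z}/p$ act on $\Gamma$ by cyclically rotating the $p$ edges of $\Theta_{p-1}$ and fixing everything else. For any choice of an isomorphism $\eta\colon F_n\to\pi_1(\Gamma,*)$, let $B_k\le \mathrm{Aut}(F_n)$ be the subgroup through which this action is induced on $F_n$ (another choice of $\eta$ replaces $B_k$ by a conjugate). Then there is an isomorphism of groups $$N_{\mathrm{Aut}(F_n)}(B_k)\;\cong\; N_{\Sigma_p}(\mathbb{Z}/p)\times\bigl(F_k\rtimes \mathrm{Aut}(F_k)\bigr)\times \mathrm{Aut}(F_{p-1-k}),$$ where $\Sigma_p$ is the symmetric group on $p$ letters, $\mathbb{Z}/p\le\Sigma_p$ is the subgroup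 generated by the $p$-cycle $(1\,2\,\dots\,p)$, $N_G(H)$ denotes the normalizer of $H$ in $G$, and $\mathrm{Aut}(F_k)$ acts on $F_k$ in the tautological way. -/

import Mathlib

open CategoryTheory

/-- The vertices of the graph `R_k ∨ Θ_{p-1} ∨ R_{p-1-k}`: the basepoint `base`, to which the rose
`R_k` is attached, and the other vertex `far` of the theta graph, to which the rose
`R_{p-1-k}` is attached. -/
inductive ThetaRose (p k : ℕ) : Type
  | base : ThetaRose p k
  | far : ThetaRose p k

/-- The (oriented) edges of `R_k ∨ Θ_{p-1} ∨ R_{p-1-k}`: `k` loops at the basepoint,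
`p` edges from the basepoint to the other vertex, and `p - 1 - k` loops at the other vertex. -/
inductive ThetaRose.Edge (p k : ℕ) : ThetaRose p k → ThetaRose p k → Type
  | leftLoop (i : Fin k) : ThetaRose.Edge p k ThetaRose.base ThetaRose.base
  | theta (i : Fin p) : ThetaRose.Edge p k ThetaRose.base ThetaRose.far
  | rightLoop (i : Fin (p - 1 - k)) : ThetaRose.Edge p k ThetaRose.far ThetaRose.far

namespace ThetaRose

/-- `R_k ∨ Θ_{p-1} ∨ R_{p-1-k}` as a directed multigraph. -/
instance instQuiver (p k : ℕ) : Quiver.{0} (ThetaRose p k) where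
  Hom := Edge p k

/-- The action on edges of the graph automorphism that permutes the `p` edges of the theta graph
by `σ` and fixes all loops. -/
def permEdge (p k : ℕ) (σ : Equiv.Perm (Fin p)) :
    ∀ {X Y : ThetaRose p k}, Edge p k X Y → Edge p k X Y
  | _, _, .leftLoop i => .leftLoop i
  | _, _, .theta i => .theta (σ i)
  | _, _, .rightLoop i => .rightLoop i

/-- The graph automorphism that fixes both vertices and all loops and permutes the `p` edges
of the theta graph by `σ`. -/
def permGraph (p k : ℕ) (σ : Equiv.Perm (Fin p)) : ThetaRose p k ⥤q ThetaRose p k where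
  obj X := X
  map e := permEdge p k σ e

/-- The fundamental group of the graph at its basepoint: homotopy classes of edge loops, that is,
the vertex group at `base` of the fundamental groupoid (the free groupoid on the graph). -/
abbrev PiOne (p k : ℕ) : Type :=
  (Quiver.FreeGroupoid.of (ThetaRose p k)).obj base ⟶
    (Quiver.FreeGroupoid.of (ThetaRose p k)).obj base

/-- The endomorphism of the fundamental group induced by the graph automorphism `permGraph`. -/
def permEnd (p k : ℕ) (σ : Equiv.Perm (Fin p)) : PiOne p k →* PiOne p k where
  toFun x := (Quiver.freeGroupoidFunctor (permGraph p k σ)).map x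
  map_one' := (Quiver.freeGroupoidFunctor (permGraph p k σ)).map_id _
  map_mul' x y := (Quiver.freeGroupoidFunctor (permGraph p k σ)).map_comp x y

theorem permGraph_one (p k : ℕ) : permGraph p k 1 = Prefunctor.id _ := by
  refine Prefunctor.ext (fun _ => rfl) ?_
  rintro _ _ (_ | _ | _) <;> rfl

theorem permGraph_mul (p k : ℕ) (σ τ : Equiv.Perm (Fin p)) :
    permGraph p k (σ * τ) = permGraph p k τ ⋙q permGraph p k σ := by
  refine Prefunctor.ext (fun _ => rfl) ?_
  rintro _ _ (_ | _ | _) <;> rfl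

theorem permEnd_one (p k : ℕ) (x : PiOne p k) : permEnd p k 1 x = x := by
  have h : Quiver.freeGroupoidFunctor (permGraph p k 1) = 𝟭 _ := by
    rw [permGraph_one, Quiver.freeGroupoidFunctor_id]
  exact eq_of_heq (Functor.hcongr_hom h x)

theorem permEnd_mul (p k : ℕ) (σ τ : Equiv.Perm (Fin p)) (x : PiOne p k) :
    permEnd p k (σ * τ) x = permEnd p k σ (permEnd p k τ x) := by
  have h : Quiver.freeGroupoidFunctor (permGraph p k (σ * τ)) =
      Quiver.freeGroupoidFunctor (permGraph p k τ) ⋙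
        Quiver.freeGroupoidFunctor (permGraph p k σ) := by
    rw [permGraph_mul, Quiver.freeGroupoidFunctor_comp]
  exact eq_of_heq (Functor.hcongr_hom h x)

/-- The action of the symmetric group `Σ_p` on the fundamental group of
`R_k ∨ Θ_{p-1} ∨ R_{p-1-k}` that is induced by permuting the edges of the theta graph. -/
def permAut (p k : ℕ) : Equiv.Perm (Fin p) →* MulAut (PiOne p k) where
  toFun σ :=
    { toFun := permEnd p k σ
      invFun := permEnd p k σ⁻¹
      left_inv := fun x => by rw [← permEnd_mul, inv_mul_cancel, permEnd_one]
      right_inv := fun x => by rw [← permEnd_mul, mul_inv_cancel, permEnd_one]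
      map_mul' := map_mul _ }
  map_one' := MulEquiv.ext fun x => permEnd_one p k x
  map_mul' σ τ := MulEquiv.ext fun x => permEnd_mul p k σ τ x

end ThetaRose

/-- The subgroup `ℤ/p` of the symmetric group `Σ_p`, generated by the cycle `(1 2 … p)`. -/
def cyclicRotations (p : ℕ) : Subgroup (Equiv.Perm (Fin p)) :=
  Subgroup.zpowers (finRotate p)

/-- The subgroup `B_k` of `Aut(F_n)`, `n = 2(p-1)`, given by the action of `ℤ/p` on
`R_k ∨ Θ_{p-1} ∨ R_{p-1-k}` that rotates the edges of the theta graph. It depends on a marking,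
an identification `η` of `F_n` with the fundamental group of the graph; another
marking gives a conjugate subgroup. -/
def subgroupB (p k : ℕ) (η : FreeGroup (Fin (2 * (p - 1))) ≃* ThetaRose.PiOne p k) :
    Subgroup (MulAut (FreeGroup (Fin (2 * (p - 1))))) :=
  ((cyclicRotations p).map (ThetaRose.permAut p k)).map (MulAut.congr η.symm).toMonoidHom

/-! Write `C` for the group of rotations. The normalizer is computed from the automorphisms that
commute with `C`, and these are read off from the semidirect product of the fundamental group with
`C`. By Bass–Serre theory this is the fundamental group of the quotient graph of groups: the theta
edges become one edge with trivial group, and each loop commutes with the stabilizer of its vertex.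
So it is the free product of `F_k × C` and `F_{p-1-k} × C` (`semidirectEquiv`).

An automorphism that commutes with `C` extends by the identity on `C` to an automorphism of this
free product over `C`. It fixes the copy of `C` in the first factor, hence preserves that factor,
because factors are malnormal (`mem_range_of_of_conj`). Torsion is conjugate into a factor, so the
copy of `C` in the second factor goes to a conjugate of itself by some `g`, and the second factor
goes to its conjugate by `g`. Surjectivity forces `g` to be a product of elements of the two factors
(`exists_eq_of_mul_of_of_surjective`), and the element of the second factor can be dropped. What
remains is an automorphism of each rose group, an element of `F_k` and a rotation
(`exists_of_map_of_false`), and these data define a symmetry of the required form.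

Finally, every automorphism of `C` induced by the normalizer is also induced by a permutation that
normalizes `C` in `Σ_p`. Dividing by that permutation reduces the normalizer to the centralizer
(`range_normalizingAut`). -/

namespace Monoid.CoprodI

variable {ι : Type*} {G : ι → Type*} [∀ i, Group (G i)]

/-! ### Normal forms, malnormality and torsion in free products. -/

namespace NeWord

theorem toList_eq_of_prod_eq {i j i' j' : ι} {v : NeWord G i j} {w : NeWord G i' j'}
    (h : v.prod = w.prod) : v.toList = w.toList := by
  classical
  have h' : v.toWord = w.toWord := Word.equiv.symm.injective h
  exact congrArg Word.toList h'

theorem head_index_eq_of_prod_eq {i j i' j' : ι} {v : NeWord G i j} {w : NeWord G i' j'}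
    (h : v.prod = w.prod) : i = i' := by
  have h' := congrArg List.head? (toList_eq_of_prod_eq h)
  rw [toList_head?, toList_head?] at h'
  exact congrArg Sigma.fst (Option.some.inj h')

theorem prod_ne_one {i j : ι} (w : NeWord G i j) : w.prod ≠ 1 := by
  classical
  intro h
  have h' : w.toWord = Word.empty := Word.equiv.symm.injective (h.trans Word.prod_empty.symm)
  exact w.toList_ne_nil (congrArg Word.toList h')

theorem exists_prod_eq {x : CoprodI G} (hx : x ≠ 1) :
    ∃ (i j : ι) (w : NeWord G i j), w.prod = x := by
  classical
  obtain ⟨i, j, w, hw⟩ := of_word (Word.equiv x) (fun h => hx (by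
    rw [← Word.equiv.symm_apply_apply x, h]; exact Word.prod_empty))
  refine ⟨i, j, w, ?_⟩
  rw [prod, hw]
  exact Word.equiv.symm_apply_apply x

theorem length_pos {i j : ι} (w : NeWord G i j) : 0 < w.toList.length :=
  List.length_pos_of_ne_nil w.toList_ne_nil

theorem length_append {i j k l : ι} (v : NeWord G i j) (h : j ≠ k) (w : NeWord G k l) :
    (append v h w).toList.length = v.toList.length + w.toList.length := by
  simp [toList]

theorem exists_pow_eq {i j : ι} (h : j ≠ i) (w : NeWord G i j) (n : ℕ) :
    ∃ v : NeWord G i j, v.prod = w.prod ^ (n + 1) := by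
  induction n with
  | zero => exact ⟨w, by simp⟩
  | succ n ih =>
    obtain ⟨v, hv⟩ := ih
    exact ⟨append v h w, by rw [append_prod, hv, ← pow_succ]⟩

/-- Split off a last letter from the factor `k`. -/
theorem exists_eq_mul_of {i j : ι} (w : NeWord G i j) (k : ι) :
    (i = k ∧ ∃ a : G k, w.prod = of a) ∨
      ∃ (l : ι) (_ : l ≠ k) (v : NeWord G i l) (a : G k),
        w.prod = v.prod * of a ∧ v.toList.length ≤ w.toList.length := by
  induction w with
  | @singleton i x hx =>
    by_cases h : i = k
    · subst h
      exact Or.inl ⟨rfl, x, by simp⟩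
    -- A word that ends outside the factor `k` gets the trivial last letter.
    · exact Or.inr ⟨i, h, singleton x hx, 1, by simp, le_rfl⟩
  | @append i j l m v hne w _ ihw =>
    rcases ihw with ⟨rfl, a, ha⟩ | ⟨n, hn, u, a, ha, hu⟩
    · refine Or.inr ⟨j, hne, v, a, by rw [append_prod, ha], ?_⟩
      rw [length_append]
      omega
    · refine Or.inr ⟨n, hn, append v hne u, a,
        by rw [append_prod, append_prod, ha, mul_assoc], ?_⟩
      rw [length_append, length_append]
      omega

/-- Split off the first letter. -/
theorem exists_eq_of_head_mul {i j : ι} (w : NeWord G i j) :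
    (i = j ∧ w.prod = of w.head) ∨
      ∃ (k : ι) (v : NeWord G k j),
        w.prod = of w.head * v.prod ∧ v.toList.length < w.toList.length := by
  induction w with
  | singleton x hx => exact Or.inl ⟨rfl, by simp⟩
  | @append i j l m v hne w ihv _ =>
    rcases ihv with ⟨rfl, hv⟩ | ⟨k, u, hu, hlt⟩
    · refine Or.inr ⟨l, w, by rw [append_prod, hv, append_head], ?_⟩
      have := v.length_pos
      rw [length_append]
      omega
    · refine Or.inr ⟨k, append u hne w,
        by rw [append_prod, append_prod, hu, append_head, mul_assoc], ?_⟩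
      rw [length_append, length_append]
      omega

end NeWord

/-- The factors of a free product are malnormal. -/
theorem mem_range_of_of_conj {i : ι} {c d : G i} (hc : c ≠ 1) {x : CoprodI G}
    (h : x * of c * x⁻¹ = of d) : ∃ a : G i, x = of a := by
  by_cases hx : x = 1
  · exact ⟨1, by simp [hx]⟩
  obtain ⟨j, k, w, rfl⟩ := NeWord.exists_prod_eq hx
  rcases w.exists_eq_mul_of i with ⟨_, a, ha⟩ | ⟨l, hl, v, a, ha, -⟩
  · exact ⟨a, ha⟩
  exfalso
  have hac : a * c * a⁻¹ ≠ 1 := by simpa using hc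
  have hd : d ≠ 1 := by
    rintro rfl
    rw [map_one, conj_eq_one_iff] at h
    exact hc (of_injective i (h.trans (map_one _).symm))
  -- With `x = v a`, the conjugate is the reduced word `v (a c a⁻¹) v⁻¹` of at least three letters,
  -- whereas `d` is a single letter.
  have key : (NeWord.append v hl (NeWord.append (NeWord.singleton _ hac) hl.symm v.inv)).prod =
      (NeWord.singleton d hd).prod := by
    rw [NeWord.prod_singleton, ← h, ha]
    simp [mul_assoc]
  have := congrArg List.length (NeWord.toList_eq_of_prod_eq key)
  rw [NeWord.length_append, NeWord.length_append] at this
  have h1 := v.length_pos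
  have h2 := v.inv.length_pos
  simp only [NeWord.toList, List.length_singleton] at this
  omega

/-- Cyclic reduction: a nontrivial element of a free product is conjugate into a factor, or
conjugate to a cyclically reduced word. -/
theorem exists_conj_of_or_neWord (x : CoprodI G) (hx : x ≠ 1) :
    (∃ (g : CoprodI G) (i : ι) (a : G i), x = g * of a * g⁻¹) ∨
      ∃ (g : CoprodI G) (i j : ι) (_ : j ≠ i) (w : NeWord G i j), x = g * w.prod * g⁻¹ := by
  obtain ⟨i, j, w, rfl⟩ := NeWord.exists_prod_eq hx
  induction hn : w.toList.length using Nat.strong_induction_on generalizing i j with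
  | _ n ih =>
  by_cases hij : j = i
  swap
  · exact Or.inr ⟨1, i, j, hij, w, by simp⟩
  subst hij
  rcases w.exists_eq_mul_of j with ⟨_, a, ha⟩ | ⟨l, hl, v, a, ha, hv⟩
  · exact Or.inl ⟨1, j, a, by simp [ha]⟩
  -- The last letter moves to the front, where the word also begins in the factor `j`. It either
  -- cancels the first letter, and induction applies, or merges with it, and the result is
  -- cyclically reduced.
  have hconj : w.prod = (of a)⁻¹ * (of a * v.prod) * ((of a)⁻¹)⁻¹ := by
    rw [ha]
    group
  by_cases h : a * v.head = 1
  · rcases v.exists_eq_of_head_mul with ⟨h', _⟩ | ⟨k, u, hu, hlt⟩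
    · exact absurd h'.symm hl
    have hav : of a * v.prod = u.prod := by
      rw [hu, ← mul_assoc, ← map_mul, h, map_one, one_mul]
    rw [hav] at hconj
    rcases ih _ (by omega) k l u u.prod_ne_one rfl with
      ⟨g, i, b, hb⟩ | ⟨g, i, m, him, u', hu'⟩
    · exact Or.inl ⟨(of a)⁻¹ * g, i, b, by rw [hconj, hb]; group⟩
    · exact Or.inr ⟨(of a)⁻¹ * g, i, m, him, u', by rw [hconj, hu']; group⟩
  · exact Or.inr ⟨(of a)⁻¹, j, l, hl, v.mulHead a h, by rw [NeWord.mulHead_prod, ← hconj]⟩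

/-- Elements of finite order of a free product are conjugate into a factor. -/
theorem exists_conj_of_of_pow_eq_one {x : CoprodI G} (hx : x ≠ 1) {n : ℕ} (hn : n ≠ 0)
    (hxn : x ^ n = 1) : ∃ (g : CoprodI G) (i : ι) (a : G i), x = g * of a * g⁻¹ := by
  rcases exists_conj_of_or_neWord x hx with h | ⟨g, i, j, hij, w, rfl⟩
  · exact h
  exfalso
  obtain ⟨n, rfl⟩ := Nat.exists_eq_succ_of_ne_zero hn
  -- Positive powers of a cyclically reduced word are reduced, hence nontrivial.
  obtain ⟨v, hv⟩ := w.exists_pow_eq hij n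
  rw [conj_pow, conj_eq_one_iff] at hxn
  exact v.prod_ne_one (hv.trans hxn)

/-! ### Conjugating one of two free factors. -/

section TwoFactors

variable {A : Bool → Type*} [∀ i, Group (A i)]

/-- Every element is a product of elements of the two factors, or such a product with a reduced word
from the second to the first factor in between. -/
theorem exists_eq_of_mul_of (g : CoprodI A) :
    (∃ (a : A false) (b : A true), g = of a * of b) ∨
      ∃ (a : A false) (b : A true) (w : NeWord A true false), g = of a * w.prod * of b := by
  by_cases hg : g = 1
  · exact Or.inl ⟨1, 1, by simp [hg]⟩
  obtain ⟨j, k, w, rfl⟩ := NeWord.exists_prod_eq hg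
  rcases w.exists_eq_mul_of true with ⟨rfl, b, hb⟩ | ⟨l, hl, v, b, hb, -⟩
  · exact Or.inl ⟨1, b, by simp [hb]⟩
  obtain rfl : l = false := by simpa using hl
  rcases v.inv.exists_eq_mul_of false with ⟨_, a, ha⟩ | ⟨m, hm, u, a, ha, -⟩
  · refine Or.inl ⟨a⁻¹, b, ?_⟩
    rw [hb, map_inv, ← ha, NeWord.inv_prod, inv_inv]
  rw [NeWord.inv_prod] at ha
  have hv : v.prod = of a⁻¹ * u.inv.prod := by
    rw [← inv_inv v.prod, ha, NeWord.inv_prod, map_inv, mul_inv_rev]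
  cases j with
  | true => exact Or.inr ⟨1, b, v, by simp [hb]⟩
  | false =>
    obtain rfl : m = true := by simpa using hm
    exact Or.inr ⟨a⁻¹, b, u.inv, by rw [hb, hv]⟩

/-- The homomorphism that is the identity on the first factor and a conjugation on the second. -/
def conjSnd (g : CoprodI A) : CoprodI A →* CoprodI A :=
  lift fun i => match i with
    | false => of
    | true => (MulAut.conj g).toMonoidHom.comp of

@[simp] theorem conjSnd_of_false (g : CoprodI A) (a : A false) : conjSnd g (of a) = of a := by
  rw [conjSnd, lift_of]

@[simp] theorem conjSnd_of_true (g : CoprodI A) (b : A true) :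
    conjSnd g (of b) = g * of b * g⁻¹ := by
  rw [conjSnd, lift_of]
  rfl

/-- As `u` starts in the second factor and ends in the first, replacing each letter `x` of the
second factor by `u x u⁻¹` causes no cancellation and preserves the end factors. Only a single
letter of the first factor has an image of length one. -/
theorem exists_neWord_conjSnd (u : NeWord A true false) {i j : Bool} (w : NeWord A i j) :
    ∃ v : NeWord A i j, v.prod = conjSnd u.prod w.prod ∧
      (v.toList.length = 1 → i = false) := by
  induction w with
  | @singleton i x hx =>
    cases i with
    | false => exact ⟨NeWord.singleton x hx, by simp, fun _ => rfl⟩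
    | true =>
      refine ⟨NeWord.append u (by simp) (NeWord.append (NeWord.singleton x hx) (by simp) u.inv),
        by simp [mul_assoc], fun h => ?_⟩
      have h1 := u.length_pos
      have h2 := u.inv.length_pos
      rw [NeWord.length_append, NeWord.length_append] at h
      omega
  | append v hne w ihv ihw =>
    obtain ⟨v', hv', -⟩ := ihv
    obtain ⟨w', hw', -⟩ := ihw
    refine ⟨NeWord.append v' hne w', by simp [hv', hw'], fun h => ?_⟩
    have h1 := v'.length_pos
    have h2 := w'.length_pos
    rw [NeWord.length_append] at h
    omega

/-- If the first factor and a conjugate of the second generate the free product, then the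
conjugating element is a product of elements of the two factors. -/
theorem exists_eq_of_mul_of_of_surjective [Nontrivial (A true)] {g : CoprodI A}
    (hg : Function.Surjective (conjSnd g)) : ∃ (a : A false) (b : A true), g = of a * of b := by
  rcases exists_eq_of_mul_of g with h | ⟨a, b, u, rfl⟩
  · exact h
  exfalso
  -- The outer letters `a` and `b` contribute only an inner automorphism and conjugations within the
  -- factors, so they do not affect surjectivity.
  have hu : Function.Surjective (conjSnd u.prod) := by
    have h : ((MulAut.conj (of a)).toMonoidHom.comp ((conjSnd u.prod).comp
        (lift fun i => match i with
          | false => (of : A false →* CoprodI A).comp (MulAut.conj a⁻¹).toMonoidHom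
          | true => (of : A true →* CoprodI A).comp (MulAut.conj b).toMonoidHom))) =
        conjSnd (of a * u.prod * of b) := by
      refine ext_hom _ _ fun i => ?_
      ext x
      cases i <;> simp [mul_assoc]
    rw [← h] at hg
    have h1 := (MulAut.conj (of a : CoprodI A)).symm.surjective.comp hg
    have h2 : Function.Surjective ((conjSnd u.prod).comp
        (lift fun i => match i with
          | false => (of : A false →* CoprodI A).comp (MulAut.conj a⁻¹).toMonoidHom
          | true => (of : A true →* CoprodI A).comp (MulAut.conj b).toMonoidHom)) := by
      refine fun y => (h1 y).imp fun x hx => ?_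
      rw [← hx]
      exact ((MulAut.conj (of a : CoprodI A)).symm_apply_apply _).symm
    exact Function.Surjective.of_comp h2
  -- A nontrivial letter of the second factor is not an image, since images of length one lie in the
  -- first factor.
  obtain ⟨t, ht⟩ := exists_ne (1 : A true)
  obtain ⟨x, hx⟩ := hu (of t)
  have hx1 : x ≠ 1 := by
    rintro rfl
    rw [map_one] at hx
    exact ht (of_injective true (hx.symm.trans (map_one _).symm))
  obtain ⟨i, j, w, rfl⟩ := NeWord.exists_prod_eq hx1
  obtain ⟨v, hv, hlen⟩ := exists_neWord_conjSnd u w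
  have key : v.prod = (NeWord.singleton t ht).prod := by rw [hv, hx, NeWord.prod_singleton]
  have hi := hlen (by rw [NeWord.toList_eq_of_prod_eq key]; rfl)
  have hi' := NeWord.head_index_eq_of_prod_eq key
  simp [hi] at hi'

end TwoFactors

end Monoid.CoprodI

/-! ### Automorphisms of a free product of two groups `F i × C`. -/

namespace Monoid.CoprodI

section CentralFactor

variable {F : Bool → Type*} [∀ i, Group (F i)] {C : Type*} [Group C]

/-- The projection of the free product of the groups `F i × C` to `C`. -/
def toCentral (F : Bool → Type*) [∀ i, Group (F i)] (C : Type*) [Group C] :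
    CoprodI (fun i => F i × C) →* C :=
  lift fun i => MonoidHom.snd (F i) C

@[simp] theorem toCentral_of {i : Bool} (x : F i × C) :
    toCentral F C (of (M := fun i => F i × C) x) = x.2 := by
  rw [toCentral, lift_of]
  rfl

variable (hC : ∀ a b : C, a * b = b * a)
include hC

/-- The image of `(x, d)` commutes with the fixed element `(1, c)`, so malnormality puts it in the
factor `i`. Its `C`-coordinate is `d` because `ψ` is over `C`. -/
theorem exists_map_of_eq_of {i : Bool} {ψ : MulAut (CoprodI fun i => F i × C)}
    (hψ : ∀ x, toCentral F C (ψ x) = toCentral F C x) {c : C} (hc : c ≠ 1)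
    (hψc : ψ (of (M := fun i => F i × C) (i := i) (1, c)) = of (i := i) (1, c)) (x : F i) (d : C) :
    ∃ y : F i, ψ (of (M := fun i => F i × C) (i := i) (x, d)) = of (i := i) (y, d) := by
  have hcomm : ((x, d) : F i × C) * (1, c) * (x, d)⁻¹ = (1, c) := by
    ext
    · simp
    · simp [hC d c]
  have h1 : ((1, c) : F i × C) ≠ 1 := fun h => hc (congrArg Prod.snd h)
  have key := congrArg (fun z => ψ (of (M := fun i => F i × C) (i := i) z)) hcomm
  simp only [map_mul, map_inv, hψc] at key
  obtain ⟨⟨y, e⟩, hy⟩ := mem_range_of_of_conj (G := fun i => F i × C) h1 key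
  have he := hψ (of (M := fun i => F i × C) (i := i) (x, d))
  rw [hy, toCentral_of, toCentral_of] at he
  exact ⟨y, by rw [hy]; exact congrArg (fun e => of (M := fun i => F i × C) (i := i) (y, e)) he⟩

/-- An automorphism over `C` that fixes a nontrivial element of the copy of `C` in a factor
restricts to an automorphism of that factor. -/
theorem exists_mulAut_of_map_of_eq {i : Bool} {ψ : MulAut (CoprodI fun i => F i × C)}
    (hψ : ∀ x, toCentral F C (ψ x) = toCentral F C x) {c : C} (hc : c ≠ 1)
    (hψc : ψ (of (M := fun i => F i × C) (i := i) (1, c)) = of (i := i) (1, c)) :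
    ∃ β : MulAut (F i), ∀ x : F i,
      ψ (of (M := fun i => F i × C) (i := i) (x, 1)) = of (i := i) (β x, 1) := by
  have hψ' : ∀ x, toCentral F C (ψ⁻¹ x) = toCentral F C x := fun x => by
    rw [← hψ (ψ⁻¹ x), MulAut.apply_inv_self]
  have hψc' : ψ⁻¹ (of (M := fun i => F i × C) (i := i) (1, c)) = of (i := i) (1, c) := by
    conv_lhs => rw [← hψc, MulAut.inv_apply_self]
  choose b hb using fun x => exists_map_of_eq_of hC hψ hc hψc x 1
  choose b' hb' using fun x => exists_map_of_eq_of hC hψ' hc hψc' x 1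
  have inj : ∀ {x y : F i}, of (M := fun i => F i × C) (i := i) (x, 1) =
      of (M := fun i => F i × C) (i := i) (y, 1) → x = y := fun h =>
    congrArg Prod.fst (of_injective (M := fun i => F i × C) i h)
  refine ⟨⟨⟨b, b', fun x => inj ?_, fun x => inj ?_⟩, fun x y => inj ?_⟩, hb⟩
  · rw [← hb', ← hb, MulAut.inv_apply_self]
  · rw [← hb, ← hb', MulAut.apply_inv_self]
  · have h : ∀ x y : F i, of (M := fun i => F i × C) (i := i) (x * y, 1) =
        of (M := fun i => F i × C) (i := i) (x, 1) * of (M := fun i => F i × C) (i := i) (y, 1) :=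
      fun x y => by rw [← map_mul]; simp
    rw [← hb, h, h, map_mul, hb, hb]

omit hC in
/-- The copies of an element of `C` in the two factors are not conjugate. -/
theorem of_true_ne_conj_of_false {c : C} (hc : c ≠ 1) (g : CoprodI fun i => F i × C) :
    of (M := fun i => F i × C) (i := true) (1, c) ≠
      g * of (M := fun i => F i × C) (i := false) (1, c) * g⁻¹ := by
  intro h
  -- The projection that kills the first factor separates the two copies.
  have key := congrArg (lift (M := fun i => F i × C) (fun i => match i with
    | false => (1 : F false × C →* F true × C)
    | true => MonoidHom.id (F true × C))) h
  simp only [map_mul, map_inv, lift_of] at key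
  simp at key
  exact hc key

variable [∀ i, IsMulTorsionFree (F i)]

/-- Torsion is conjugate into a factor, where its free coordinate vanishes. Its `C`-coordinate is
unchanged by conjugation, as `C` is abelian. -/
theorem exists_conj_of_torsion {x : CoprodI fun i => F i × C} {n : ℕ} (hn : n ≠ 0)
    (hxn : x ^ n = 1) (hx : toCentral F C x ≠ 1) :
    ∃ (g : CoprodI fun i => F i × C) (i : Bool),
      x = g * of (M := fun i => F i × C) (i := i) (1, toCentral F C x) * g⁻¹ := by
  have hx1 : x ≠ 1 := fun h => hx (by rw [h, map_one])
  obtain ⟨g, i, ⟨y, c⟩, h⟩ := exists_conj_of_of_pow_eq_one hx1 hn hxn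
  have hc : toCentral F C x = c := by
    rw [h, map_mul, map_mul, toCentral_of, map_inv, hC, inv_mul_cancel_left]
  rw [h, conj_pow, conj_eq_one_iff, ← map_pow] at hxn
  have hy : y ^ n = 1 :=
    congrArg Prod.fst (of_injective (M := fun i => F i × C) i (hxn.trans (map_one _).symm))
  have hy1 : y = 1 := pow_left_injective hn (by simpa using hy)
  subst hy1
  exact ⟨g, i, by rw [hc]; exact h⟩

variable [Finite C]

/-- Automorphisms over `C` of the free product of the groups `F i × C` that fix the copy of `C` in
the first factor. -/
theorem exists_of_map_of_false {c : C} (hc : c ≠ 1) {φ : MulAut (CoprodI fun i => F i × C)}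
    (hφ : ∀ x, toCentral F C (φ x) = toCentral F C x)
    (hφc : φ (of (M := fun i => F i × C) (i := false) (1, c)) = of (i := false) (1, c)) :
    ∃ (β : ∀ i, MulAut (F i)) (a : F false × C),
      (∀ x, φ (of (M := fun i => F i × C) (i := false) (x, 1)) =
        of (i := false) (β false x, 1)) ∧
      (∀ x, φ (of (M := fun i => F i × C) (i := true) (x, 1)) =
        of (M := fun i => F i × C) (i := false) a * of (i := true) (β true x, 1) *
          (of (M := fun i => F i × C) (i := false) a)⁻¹) ∧
      ∀ d, φ (of (M := fun i => F i × C) (i := true) (1, d)) =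
        of (M := fun i => F i × C) (i := false) a * of (i := true) (1, d) *
          (of (M := fun i => F i × C) (i := false) a)⁻¹ := by
  have htors : ∀ (i : Bool) (d : C),
      (of (M := fun i => F i × C) (i := i) (1, d)) ^ Nat.card C = 1 := fun i d => by
    rw [← map_pow, Prod.pow_mk, pow_card_eq_one', one_pow]
    exact map_one _
  have hcard : Nat.card C ≠ 0 := Nat.card_pos.ne'
  -- The image is torsion over `c`. If it were conjugate to the copy of `c` in the first factor,
  -- which `φ` fixes, then applying `φ⁻¹` would make the two copies of `c` conjugate.
  have hconj : ∃ g, φ (of (M := fun i => F i × C) (i := true) (1, c)) =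
      g * of (M := fun i => F i × C) (i := true) (1, c) * g⁻¹ := by
    have h1 : toCentral F C (φ (of (M := fun i => F i × C) (i := true) (1, c))) = c := by
      rw [hφ, toCentral_of]
    obtain ⟨g, i, h⟩ := exists_conj_of_torsion hC hcard
      (x := φ (of (M := fun i => F i × C) (i := true) (1, c)))
      (by rw [← map_pow, htors, map_one]) (by rwa [h1])
    rw [h1] at h
    cases i with
    | true => exact ⟨g, h⟩
    | false =>
      exfalso
      refine of_true_ne_conj_of_false (F := F) hc (φ⁻¹ g) (φ.injective ?_)
      rw [h, map_mul, map_mul, map_inv, MulAut.apply_inv_self, hφc]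
  obtain ⟨g, hg⟩ := hconj
  have hover : ∀ (g : CoprodI fun i => F i × C) x,
      toCentral F C ((MulAut.conj g⁻¹ * φ) x) = toCentral F C x := fun g x => by
    rw [MulAut.mul_apply, MulAut.conj_apply, map_mul, map_mul, hφ, hC, ← mul_assoc, ← map_mul]
    simp
  have hfix : ∀ g : CoprodI fun i => F i × C,
      φ (of (M := fun i => F i × C) (i := true) (1, c)) =
        g * of (M := fun i => F i × C) (i := true) (1, c) * g⁻¹ →
      (MulAut.conj g⁻¹ * φ) (of (M := fun i => F i × C) (i := true) (1, c)) =
        of (i := true) (1, c) := fun g hg => by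
    rw [MulAut.mul_apply, MulAut.conj_apply, hg]
    group
  obtain ⟨β₀, hβ₀⟩ := exists_mulAut_of_map_of_eq hC hφ hc hφc
  -- Since `φ` maps the first factor to itself and the second to its conjugate by `g`, its range
  -- lies in that of `conjSnd g`.
  have hsurj : Function.Surjective (conjSnd (A := fun i => F i × C) g) := by
    rw [← MonoidHom.range_eq_top, eq_top_iff]
    have hφtop : (φ.toMonoidHom : _ →* CoprodI fun i => F i × C).range = ⊤ :=
      MonoidHom.range_eq_top.2 φ.surjective
    rw [← hφtop]
    rintro _ ⟨x, rfl⟩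
    induction x using induction_on with
    | one => exact ⟨1, by simp⟩
    | mul x y hx hy =>
      rw [map_mul]
      exact mul_mem hx hy
    | of i x =>
      obtain ⟨x, d⟩ := x
      cases i with
      | false =>
        obtain ⟨y, hy⟩ := exists_map_of_eq_of hC hφ hc hφc x d
        exact ⟨of (i := false) (y, d), by simpa using hy.symm⟩
      | true =>
        obtain ⟨y, hy⟩ := exists_map_of_eq_of hC (hover g) hc (hfix g hg) x d
        refine ⟨of (i := true) (y, d), ?_⟩
        rw [conjSnd_of_true, ← hy, MulAut.mul_apply, MulAut.conj_apply]
        simp [mul_assoc]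
  have : Nontrivial (F true × C) := ⟨(1, c), 1, fun h => hc (congrArg Prod.snd h)⟩
  obtain ⟨a, ⟨y, e⟩, rfl⟩ := exists_eq_of_mul_of_of_surjective hsurj
  -- The element `(y, e)` of the second factor centralizes `(1, c)`, so it drops out of the
  -- conjugation.
  have ha : φ (of (M := fun i => F i × C) (i := true) (1, c)) =
      of (M := fun i => F i × C) (i := false) a * of (i := true) (1, c) *
        (of (M := fun i => F i × C) (i := false) a)⁻¹ := by
    have h : ((y, e) : F true × C) * (1, c) * (y, e)⁻¹ = (1, c) := by
      ext
      · simp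
      · simp [hC e c]
    have h' := congrArg (fun z => of (M := fun i => F i × C) (i := true) z) h
    simp only [map_mul, map_inv] at h'
    rw [hg]
    conv_rhs => rw [← h']
    group
  have hback : ∀ x z, (MulAut.conj (of (M := fun i => F i × C) (i := false) a)⁻¹ * φ) x = z →
      φ x = of (M := fun i => F i × C) (i := false) a * z *
        (of (M := fun i => F i × C) (i := false) a)⁻¹ := by
    rintro x _ rfl
    rw [MulAut.mul_apply, MulAut.conj_apply]
    group
  obtain ⟨β₁, hβ₁⟩ := exists_mulAut_of_map_of_eq hC (hover _) hc (hfix _ ha)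
  refine ⟨fun i => match i with
    | false => β₀
    | true => β₁, a, hβ₀, fun x => hback _ _ (hβ₁ x), fun d => hback _ _ ?_⟩
  -- The free coordinate `z` of the image of `(1, d)` is torsion, hence trivial.
  obtain ⟨z, hz⟩ := exists_map_of_eq_of hC (hover _) hc (hfix _ ha) 1 d
  have hpow := congrArg (· ^ Nat.card C) hz
  rw [← map_pow, htors, map_one, ← map_pow] at hpow
  have hz1 : z ^ Nat.card C = 1 := congrArg Prod.fst
    (of_injective (M := fun i => F i × C) true (hpow.symm.trans (map_one _).symm))
  have hz2 : z = 1 := pow_left_injective hcard (by simpa using hz1)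
  rw [hz, hz2]

end CentralFactor

end Monoid.CoprodI

theorem CategoryTheory.Functor.map_comp_groupoid_inv {𝒞 𝒟 : Type*} [Groupoid 𝒞] [Groupoid 𝒟]
    (Φ : 𝒞 ⥤ 𝒟) {X Y Z : 𝒞} (f : X ⟶ Y) (g : Z ⟶ Y) :
    Φ.map (f ≫ Groupoid.inv g) = Φ.map f ≫ Groupoid.inv (Φ.map g) := by
  simp only [Functor.map_comp, Groupoid.inv_eq_inv, Functor.map_inv]

/-! ### Generators and universal property of the fundamental group. -/

namespace ThetaRose

variable {p k : ℕ}

/-- The left loops, as elements of the fundamental group. -/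
def leftGen (i : Fin k) : PiOne p k :=
  (Quiver.FreeGroupoid.of (ThetaRose p k)).map (Edge.leftLoop i : Edge p k base base)

/-- The edges of the theta graph, as morphisms of the fundamental groupoid. -/
def thetaHom (i : Fin p) : (Quiver.FreeGroupoid.of (ThetaRose p k)).obj base ⟶
    (Quiver.FreeGroupoid.of (ThetaRose p k)).obj far :=
  (Quiver.FreeGroupoid.of (ThetaRose p k)).map (Edge.theta i : Edge p k base far)

/-- The right loops, as morphisms of the fundamental groupoid. -/
def rightHom (j : Fin (p - 1 - k)) : (Quiver.FreeGroupoid.of (ThetaRose p k)).obj far ⟶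
    (Quiver.FreeGroupoid.of (ThetaRose p k)).obj far :=
  (Quiver.FreeGroupoid.of (ThetaRose p k)).map (Edge.rightLoop j : Edge p k far far)

/-- The loop along the `i`-th edge of the theta graph and back along the `j`-th. -/
def thetaLoop (i j : Fin p) : PiOne p k := thetaHom i ≫ Groupoid.inv (thetaHom j)

/-- The loops based at the other vertex, transported along the `i`-th edge. -/
def transport (i : Fin p) :
    ((Quiver.FreeGroupoid.of (ThetaRose p k)).obj far ⟶
      (Quiver.FreeGroupoid.of (ThetaRose p k)).obj far) →* PiOne p k where
  toFun x := thetaHom i ≫ x ≫ Groupoid.inv (thetaHom i)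
  map_one' := by
    change thetaHom i ≫ 𝟙 _ ≫ Groupoid.inv (thetaHom i) = 𝟙 _
    simp
  map_mul' x y := by
    change thetaHom i ≫ (x ≫ y) ≫ Groupoid.inv (thetaHom i) =
      (thetaHom i ≫ x ≫ Groupoid.inv (thetaHom i)) ≫ thetaHom i ≫ y ≫ Groupoid.inv (thetaHom i)
    simp

/-- The subgroup carried by the rose at the basepoint. -/
def leftHom (p k : ℕ) : FreeGroup (Fin k) →* PiOne p k := FreeGroup.lift leftGen

/-- The subgroup carried by the rose at the other vertex, transported along the `i`-th edge. -/
def rightLoops (i : Fin p) : FreeGroup (Fin (p - 1 - k)) →* PiOne p k :=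
  (transport i).comp (FreeGroup.lift rightHom)

@[simp] theorem thetaLoop_self (i : Fin p) : (thetaLoop i i : PiOne p k) = 1 :=
  Groupoid.comp_inv _

@[simp] theorem thetaLoop_mul (i j l : Fin p) :
    (thetaLoop i j * thetaLoop j l : PiOne p k) = thetaLoop i l := by
  change (thetaHom i ≫ Groupoid.inv (thetaHom j)) ≫ thetaHom j ≫ Groupoid.inv (thetaHom l) =
    thetaHom i ≫ Groupoid.inv (thetaHom l)
  simp

theorem thetaLoop_inv (i j : Fin p) : (thetaLoop i j : PiOne p k)⁻¹ = thetaLoop j i :=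
  inv_eq_of_mul_eq_one_right (by rw [thetaLoop_mul, thetaLoop_self])

theorem transport_eq (i j : Fin p) (x) :
    (transport i x : PiOne p k) = thetaLoop i j * transport j x * (thetaLoop i j)⁻¹ := by
  rw [thetaLoop_inv]
  change thetaHom i ≫ x ≫ Groupoid.inv (thetaHom i) =
    ((thetaHom i ≫ Groupoid.inv (thetaHom j)) ≫ thetaHom j ≫ x ≫ Groupoid.inv (thetaHom j)) ≫
      thetaHom j ≫ Groupoid.inv (thetaHom i)
  simp

theorem rightLoops_eq (i j : Fin p) (x) :
    (rightLoops i x : PiOne p k) = thetaLoop i j * rightLoops j x * (thetaLoop i j)⁻¹ :=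
  transport_eq i j _

section UniversalProperty

variable {H : Type*} [Group H]

/-- A labelling of the oriented edges by elements of a group, as a morphism of quivers. -/
def labelling (a : Fin k → H) (y : Fin p → H) (r : Fin (p - 1 - k) → H) :
    ThetaRose p k ⥤q SingleObj Hᵐᵒᵖ where
  obj _ := SingleObj.star _
  map e := match e with
    | Edge.leftLoop i => MulOpposite.op (a i)
    | Edge.theta i => MulOpposite.op (y i)
    | Edge.rightLoop i => MulOpposite.op (r i)

/-- The homomorphism determined by a labelling of the edges. -/
def labelHom (a : Fin k → H) (y : Fin p → H) (r : Fin (p - 1 - k) → H) : PiOne p k →* H where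
  -- Composition in `SingleObj` reverses multiplication, while loops multiply in the order of
  -- composition; hence the opposite group.
  toFun x := MulOpposite.unop ((Quiver.FreeGroupoid.lift (labelling a y r)).map x)
  map_one' := congrArg MulOpposite.unop
    ((Quiver.FreeGroupoid.lift (labelling a y r)).map_id _)
  map_mul' x z := congrArg MulOpposite.unop
    ((Quiver.FreeGroupoid.lift (labelling a y r)).map_comp x z)

variable (a : Fin k → H) (y : Fin p → H) (r : Fin (p - 1 - k) → H)

theorem lift_labelling_map {X Y : ThetaRose p k} (e : X ⟶ Y) :
    (Quiver.FreeGroupoid.lift (labelling a y r)).map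
      ((Quiver.FreeGroupoid.of (ThetaRose p k)).map e) = (labelling a y r).map e :=
  Category.id_comp _

theorem labelHom_leftGen (i : Fin k) : labelHom (p := p) a y r (leftGen i) = a i :=
  congrArg MulOpposite.unop (lift_labelling_map a y r (Edge.leftLoop i : Edge p k base base))

theorem labelHom_thetaLoop (i j : Fin p) : labelHom a y r (thetaLoop i j) = y i * (y j)⁻¹ := by
  have h : ∀ i : Fin p, (Quiver.FreeGroupoid.lift (labelling a y r)).map (thetaHom i) =
      MulOpposite.op (y i) := fun i =>
    lift_labelling_map a y r (Edge.theta i : Edge p k base far)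
  exact congrArg MulOpposite.unop ((Functor.map_comp_groupoid_inv _ _ _).trans
    (congrArg₂ (fun u v => u ≫ Groupoid.inv v) (h i) (h j)))

theorem labelHom_rightLoops_of (i : Fin p) (j : Fin (p - 1 - k)) :
    labelHom a y r (rightLoops i (FreeGroup.of j)) = y i * r j * (y i)⁻¹ := by
  have h : ∀ i : Fin p, (Quiver.FreeGroupoid.lift (labelling a y r)).map (thetaHom i) =
      MulOpposite.op (y i) := fun i =>
    lift_labelling_map a y r (Edge.theta i : Edge p k base far)
  have h' : (Quiver.FreeGroupoid.lift (labelling a y r)).map (rightHom j) =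
      MulOpposite.op (r j) :=
    lift_labelling_map a y r (Edge.rightLoop j : Edge p k far far)
  have h'' : (rightLoops i (FreeGroup.of j) : PiOne p k) =
      thetaHom i ≫ rightHom j ≫ Groupoid.inv (thetaHom i) := by
    change transport i (FreeGroup.lift rightHom (FreeGroup.of j)) = _
    rw [FreeGroup.lift_apply_of]
    rfl
  rw [h'', ← Category.assoc]
  have h₃ := (Functor.map_comp (Quiver.FreeGroupoid.lift (labelling a y r)) (thetaHom i)
    (rightHom j)).trans (congrArg₂ (fun u v => u ≫ v) (h i) h')
  refine (congrArg MulOpposite.unop ((Functor.map_comp_groupoid_inv _ _ _).trans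
    (congrArg₂ (fun u v => u ≫ Groupoid.inv v) h₃ (h i)))).trans ?_
  rfl

theorem labelHom_leftHom (x : FreeGroup (Fin k)) :
    labelHom a y r (leftHom p k x) = FreeGroup.lift a x := by
  have h : (labelHom a y r).comp (leftHom p k) = FreeGroup.lift a := by
    ext i
    simp [leftHom, labelHom_leftGen]
  exact DFunLike.congr_fun h x

theorem labelHom_rightLoops (i : Fin p) (x : FreeGroup (Fin (p - 1 - k))) :
    labelHom a y r (rightLoops i x) = y i * FreeGroup.lift r x * (y i)⁻¹ := by
  have h : (labelHom a y r).comp (rightLoops i) =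
      (MulAut.conj (y i)).toMonoidHom.comp (FreeGroup.lift r) := by
    ext j
    rw [MonoidHom.comp_apply, labelHom_rightLoops_of]
    simp
  exact DFunLike.congr_fun h x

/-- The path from the basepoint in the spanning tree given by the `i`-th edge. -/
def treeHom (i : Fin p) : ∀ X : Quiver.FreeGroupoid (ThetaRose p k),
    (Quiver.FreeGroupoid.of (ThetaRose p k)).obj base ⟶ X
  | ⟨base⟩ => 𝟙 _
  | ⟨far⟩ => thetaHom i

/-- The extension of a homomorphism on the fundamental group to the fundamental groupoid, trivial
on the spanning tree given by the `i`-th edge. -/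
def extendFunctor (i : Fin p) (f : PiOne p k →* H) :
    Quiver.FreeGroupoid (ThetaRose p k) ⥤ SingleObj Hᵐᵒᵖ where
  obj _ := SingleObj.star _
  map {X Y} x := MulOpposite.op (f (treeHom i X ≫ x ≫ Groupoid.inv (treeHom i Y)))
  map_id X := by
    have h : treeHom i X ≫ 𝟙 X ≫ Groupoid.inv (treeHom i X) = (1 : PiOne p k) := by
      change _ = 𝟙 _
      simp
    rw [h, map_one]
    rfl
  map_comp {X Y Z} x z := by
    have h : treeHom i X ≫ (x ≫ z) ≫ Groupoid.inv (treeHom i Z) =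
        ((treeHom i X ≫ x ≫ Groupoid.inv (treeHom i Y) : PiOne p k) *
          (treeHom i Y ≫ z ≫ Groupoid.inv (treeHom i Z) : PiOne p k) : PiOne p k) := by
      change _ = (treeHom i X ≫ x ≫ Groupoid.inv (treeHom i Y)) ≫
          (treeHom i Y ≫ z ≫ Groupoid.inv (treeHom i Z))
      simp
    rw [h, map_mul]
    rfl

/-- Closing each edge up through the spanning tree `i` extends `f` to a functor on the free
groupoid, which is determined by its values on edges. -/
theorem eq_labelHom (i : Fin p) (f : PiOne p k →* H) :
    f = labelHom (fun j => f (leftGen j)) (fun j => f (thetaLoop j i))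
      (fun j => f (rightLoops i (FreeGroup.of j))) := by
  have h : extendFunctor i f = Quiver.FreeGroupoid.lift (labelling (fun j => f (leftGen j))
      (fun j => f (thetaLoop j i)) (fun j => f (rightLoops i (FreeGroup.of j)))) := by
    apply Quiver.FreeGroupoid.lift_unique
    refine Prefunctor.ext (fun _ => rfl) ?_
    rintro _ _ (j | j | j)
    · refine congrArg (fun z => MulOpposite.op (f z)) ?_
      change 𝟙 _ ≫ leftGen j ≫ Groupoid.inv (𝟙 _) = _
      simp
    · refine congrArg (fun z => MulOpposite.op (f z)) ?_
      change 𝟙 _ ≫ thetaHom j ≫ Groupoid.inv (thetaHom i) = _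
      rw [Category.id_comp]
      rfl
    · refine congrArg (fun z => MulOpposite.op (f z)) ?_
      change _ = thetaHom i ≫ (FreeGroup.lift rightHom (FreeGroup.of j)) ≫
        Groupoid.inv (thetaHom i)
      rw [FreeGroup.lift_apply_of]
      rfl
  ext x
  have h' := congrArg MulOpposite.unop (eq_of_heq (Functor.hcongr_hom h x))
  refine Eq.trans (congrArg f ?_) h'
  change x = 𝟙 _ ≫ x ≫ Groupoid.inv (𝟙 _)
  simp

theorem hom_ext (i : Fin p) {f g : PiOne p k →* H}
    (hl : ∀ x, f (leftHom p k x) = g (leftHom p k x))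
    (ht : ∀ j, f (thetaLoop j i) = g (thetaLoop j i))
    (hr : ∀ x, f (rightLoops i x) = g (rightLoops i x)) : f = g := by
  have hl' : ∀ j, f (leftGen j) = g (leftGen j) := fun j => by
    simpa [leftHom] using hl (FreeGroup.of j)
  rw [eq_labelHom i f, eq_labelHom i g]
  simp only [hl', ht, hr]

end UniversalProperty

section PermAut

variable (σ : Equiv.Perm (Fin p))

theorem freeGroupoidFunctor_permGraph_map {X Y : ThetaRose p k} (e : X ⟶ Y) :
    (Quiver.freeGroupoidFunctor (permGraph p k σ)).map
      ((Quiver.FreeGroupoid.of (ThetaRose p k)).map e) =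
      (Quiver.FreeGroupoid.of (ThetaRose p k)).map (permEdge p k σ e) :=
  Category.id_comp _

@[simp] theorem permAut_leftHom (x : FreeGroup (Fin k)) :
    permAut p k σ (leftHom p k x) = leftHom p k x := by
  have h : (permAut p k σ).toMonoidHom.comp (leftHom p k) = leftHom p k := by
    ext i
    simp only [MonoidHom.comp_apply, leftHom, FreeGroup.lift_apply_of]
    exact freeGroupoidFunctor_permGraph_map σ (Edge.leftLoop i : Edge p k base base)
  exact DFunLike.congr_fun h x

@[simp] theorem permAut_thetaLoop (i j : Fin p) :
    permAut p k σ (thetaLoop i j) = thetaLoop (σ i) (σ j) := by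
  have h : ∀ i : Fin p, (Quiver.freeGroupoidFunctor (permGraph p k σ)).map (thetaHom i) =
      thetaHom (σ i) := fun i =>
    freeGroupoidFunctor_permGraph_map σ (Edge.theta i : Edge p k base far)
  exact (Functor.map_comp_groupoid_inv _ _ _).trans
    (congrArg₂ (fun u v => u ≫ Groupoid.inv v) (h i) (h j))

@[simp] theorem permAut_rightLoops (i : Fin p) (x : FreeGroup (Fin (p - 1 - k))) :
    permAut p k σ (rightLoops i x) = rightLoops (σ i) x := by
  have h : (permAut p k σ).toMonoidHom.comp (rightLoops i) = rightLoops (σ i) := by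
    ext j
    have h1 : ∀ i : Fin p, (Quiver.freeGroupoidFunctor (permGraph p k σ)).map (thetaHom i) =
        thetaHom (σ i) := fun i =>
      freeGroupoidFunctor_permGraph_map σ (Edge.theta i : Edge p k base far)
    have h2 : (Quiver.freeGroupoidFunctor (permGraph p k σ)).map (rightHom j) = rightHom j :=
      freeGroupoidFunctor_permGraph_map σ (Edge.rightLoop j : Edge p k far far)
    have h3 : ∀ i, (rightLoops i (FreeGroup.of j) : PiOne p k) =
        thetaHom i ≫ rightHom j ≫ Groupoid.inv (thetaHom i) := fun i => by
      change transport i (FreeGroup.lift rightHom (FreeGroup.of j)) = _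
      rw [FreeGroup.lift_apply_of]
      rfl
    rw [MonoidHom.comp_apply, h3, h3, ← Category.assoc, ← Category.assoc]
    have h4 := (Functor.map_comp (Quiver.freeGroupoidFunctor (permGraph p k σ)) (thetaHom i)
      (rightHom j)).trans (congrArg₂ (fun u v => u ≫ v) (h1 i) h2)
    exact (Functor.map_comp_groupoid_inv _ _ _).trans
      (congrArg₂ (fun u v => u ≫ Groupoid.inv v) h4 (h1 i))
  exact DFunLike.congr_fun h x

end PermAut

/-- The fundamental group is free, on the left loops, the right loops transported along an edge
and the loops along two edges of the theta graph. -/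
def piOneEquiv (i : Fin p) :
    PiOne p k ≃* FreeGroup (Fin k ⊕ {j : Fin p // j ≠ i} ⊕ Fin (p - 1 - k)) :=
  MonoidHom.toMulEquiv
    (labelHom (fun j => FreeGroup.of (Sum.inl j))
      -- The tree edge carries the trivial label.
      (fun j => if h : j = i then 1 else FreeGroup.of (Sum.inr (Sum.inl ⟨j, h⟩)))
      (fun j => FreeGroup.of (Sum.inr (Sum.inr j))))
    (FreeGroup.lift (Sum.elim leftGen (Sum.elim (fun j => thetaLoop j.1 i)
      (fun j => rightLoops i (FreeGroup.of j)))))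
    (by
      refine hom_ext i (fun x => ?_) (fun j => ?_) fun x => ?_
      · rw [MonoidHom.comp_apply, labelHom_leftHom]
        induction x using FreeGroup.induction_on <;> simp_all [leftHom]
      · rw [MonoidHom.comp_apply, labelHom_thetaLoop]
        by_cases h : j = i
        · subst h
          simp
        · simp [h]
      · rw [MonoidHom.comp_apply, labelHom_rightLoops]
        induction x using FreeGroup.induction_on <;> simp_all)
    (by
      ext (j | j | j)
      · simp [labelHom_leftGen]
      · simp [labelHom_thetaLoop, j.2]
      · simp [labelHom_rightLoops])

/-- The rank is `k + (p - 1) + (p - 1 - k)`; truncated subtraction is harmless because `k ≤ p - 1`.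
-/
theorem nonempty_freeGroup_equiv (hp : 0 < p) (hk : k ≤ p - 1) :
    Nonempty (FreeGroup (Fin (2 * (p - 1))) ≃* PiOne p k) := by
  have i : Fin p := ⟨0, hp⟩
  have hcard : Fintype.card (Fin k ⊕ {j : Fin p // j ≠ i} ⊕ Fin (p - 1 - k)) =
      Fintype.card (Fin (2 * (p - 1))) := by
    simp only [Fintype.card_sum, Fintype.card_fin, ne_eq, Fintype.card_subtype_compl,
      Fintype.card_unique]
    omega
  exact ⟨((piOneEquiv i).trans (FreeGroup.freeGroupCongr (Fintype.equivOfCardEq hcard))).symm⟩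

end ThetaRose

/-! ### The group of symmetries and its action. -/

namespace ThetaRose

variable {p k : ℕ}

/-- The group that acts on the fundamental group by permuting the edges of the theta graph,
by sliding the theta graph along loops and by automorphisms of the two roses. -/
abbrev Symmetry (p k : ℕ) : Type :=
  Equiv.Perm (Fin p) ×
    (FreeGroup (Fin k) ⋊[MonoidHom.id (MulAut (FreeGroup (Fin k)))] MulAut (FreeGroup (Fin k))) ×
    MulAut (FreeGroup (Fin (p - 1 - k)))

/-- The endomorphism of the fundamental group given by an element of `Symmetry p k`. -/
def symmetryEnd (i₀ : Fin p) (t : Symmetry p k) : PiOne p k →* PiOne p k :=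
  labelHom (fun i => leftHom p k (t.2.1.right (FreeGroup.of i)))
    (fun i => (leftHom p k t.2.1.left)⁻¹ * thetaLoop (t.1 i) i₀)
    (fun j => rightLoops i₀ (t.2.2 (FreeGroup.of j)))

variable (i₀ : Fin p) (t : Symmetry p k)

theorem symmetryEnd_leftHom (x : FreeGroup (Fin k)) :
    symmetryEnd i₀ t (leftHom p k x) = leftHom p k (t.2.1.right x) := by
  rw [symmetryEnd, labelHom_leftHom]
  have h : FreeGroup.lift (fun i => leftHom p k (t.2.1.right (FreeGroup.of i))) =
      (leftHom p k).comp t.2.1.right.toMonoidHom := by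
    ext i
    simp
  exact DFunLike.congr_fun h x

/-- The reference edge `i₀` cancels, so the action does not depend on it. -/
theorem symmetryEnd_thetaLoop (i j : Fin p) :
    symmetryEnd i₀ t (thetaLoop i j) =
      (leftHom p k t.2.1.left)⁻¹ * thetaLoop (t.1 i) (t.1 j) * leftHom p k t.2.1.left := by
  rw [symmetryEnd, labelHom_thetaLoop, mul_inv_rev, inv_inv, thetaLoop_inv,
    ← thetaLoop_mul (t.1 i) i₀ (t.1 j)]
  group

theorem symmetryEnd_rightLoops (i : Fin p) (x : FreeGroup (Fin (p - 1 - k))) :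
    symmetryEnd i₀ t (rightLoops i x) =
      (leftHom p k t.2.1.left)⁻¹ * rightLoops (t.1 i) (t.2.2 x) * leftHom p k t.2.1.left := by
  rw [symmetryEnd, labelHom_rightLoops]
  have h : FreeGroup.lift (fun j => (rightLoops i₀ (t.2.2 (FreeGroup.of j)) : PiOne p k)) =
      (rightLoops i₀).comp t.2.2.toMonoidHom := by
    ext i
    simp
  rw [h, rightLoops_eq (t.1 i) i₀ (t.2.2 x)]
  simp

/-- Conjugating by the inverse of the `F_k`-component matches the semidirect product law, in which
the left component of `s * t` is that of `s` times the twisted one of `t`. -/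
theorem symmetryEnd_mul (s t : Symmetry p k) :
    symmetryEnd i₀ (s * t) = (symmetryEnd i₀ s).comp (symmetryEnd i₀ t) := by
  refine hom_ext i₀ (fun x => ?_) (fun j => ?_) fun x => ?_
  · simp [symmetryEnd_leftHom]
  · rw [MonoidHom.comp_apply, symmetryEnd_thetaLoop, symmetryEnd_thetaLoop, map_mul, map_mul,
      map_inv, symmetryEnd_leftHom, symmetryEnd_thetaLoop]
    simp only [Prod.fst_mul, Prod.snd_mul, SemidirectProduct.mul_left, MonoidHom.id_apply,
      Equiv.Perm.mul_apply, map_mul, mul_inv_rev, mul_assoc]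
  · rw [MonoidHom.comp_apply, symmetryEnd_rightLoops, symmetryEnd_rightLoops, map_mul, map_mul,
      map_inv, symmetryEnd_leftHom, symmetryEnd_rightLoops]
    simp only [Prod.fst_mul, Prod.snd_mul, SemidirectProduct.mul_left, MonoidHom.id_apply,
      Equiv.Perm.mul_apply, MulAut.mul_apply, map_mul, mul_inv_rev, mul_assoc]

theorem symmetryEnd_one : symmetryEnd i₀ (1 : Symmetry p k) = MonoidHom.id _ := by
  refine hom_ext i₀ (fun x => ?_) (fun j => ?_) fun x => ?_
  · simp [symmetryEnd_leftHom]
  · simp [symmetryEnd_thetaLoop]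
  · simp [symmetryEnd_rightLoops]

/-- The action of `Symmetry p k` on the fundamental group. -/
def symmetryAut : Symmetry p k →* MulAut (PiOne p k) where
  toFun t := (symmetryEnd i₀ t).toMulEquiv (symmetryEnd i₀ t⁻¹)
    (by rw [← symmetryEnd_mul, inv_mul_cancel, symmetryEnd_one])
    (by rw [← symmetryEnd_mul, mul_inv_cancel, symmetryEnd_one])
  map_one' := MulEquiv.ext fun x => DFunLike.congr_fun (symmetryEnd_one i₀) x
  map_mul' s t := MulEquiv.ext fun x => DFunLike.congr_fun (symmetryEnd_mul i₀ s t) x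

@[simp] theorem symmetryAut_leftHom (x : FreeGroup (Fin k)) :
    symmetryAut i₀ t (leftHom p k x) = leftHom p k (t.2.1.right x) :=
  symmetryEnd_leftHom i₀ t x

@[simp] theorem symmetryAut_thetaLoop (i j : Fin p) :
    symmetryAut i₀ t (thetaLoop i j) =
      (leftHom p k t.2.1.left)⁻¹ * thetaLoop (t.1 i) (t.1 j) * leftHom p k t.2.1.left :=
  symmetryEnd_thetaLoop i₀ t i j

@[simp] theorem symmetryAut_rightLoops (i : Fin p) (x : FreeGroup (Fin (p - 1 - k))) :
    symmetryAut i₀ t (rightLoops i x) =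
      (leftHom p k t.2.1.left)⁻¹ * rightLoops (t.1 i) (t.2.2 x) * leftHom p k t.2.1.left :=
  symmetryEnd_rightLoops i₀ t i x

theorem mulAut_ext {φ ψ : MulAut (PiOne p k)}
    (hl : ∀ x, φ (leftHom p k x) = ψ (leftHom p k x))
    (ht : ∀ j, φ (thetaLoop j i₀) = ψ (thetaLoop j i₀))
    (hr : ∀ x, φ (rightLoops i₀ x) = ψ (rightLoops i₀ x)) : φ = ψ :=
  MulEquiv.toMonoidHom_injective (hom_ext i₀ (f := φ.toMonoidHom) (g := ψ.toMonoidHom) hl ht hr)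

theorem symmetryAut_perm (σ : Equiv.Perm (Fin p)) :
    symmetryAut i₀ ((σ, 1) : Symmetry p k) = permAut p k σ := by
  refine mulAut_ext i₀ (fun x => ?_) (fun j => ?_) fun x => ?_ <;> simp

/-- Trivial labels on all edges but the left loops give a retraction. -/
theorem leftHom_injective (p k : ℕ) : Function.Injective (leftHom p k) := fun x y h => by
  have := congrArg (labelHom FreeGroup.of 1 1) h
  rw [labelHom_leftHom, labelHom_leftHom] at this
  simpa [FreeGroup.lift_of_eq_id] using this

theorem rightLoops_injective (i : Fin p) :
    Function.Injective (rightLoops i : _ →* PiOne p k) := fun x y h => by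
  have := congrArg (labelHom 1 1 FreeGroup.of) h
  rw [labelHom_rightLoops, labelHom_rightLoops] at this
  simpa [FreeGroup.lift_of_eq_id] using this

/-- Labelling theta edges by basis vectors of `ℤ^p` and loops by zero sends `thetaLoop i j` to `e_i
- e_j`, a conjugacy invariant. The coefficient at `i` decides. -/
theorem eq_of_isConj_thetaLoop {i j i' j' : Fin p} (hij : i ≠ j) {g : PiOne p k}
    (h : g * thetaLoop i j * g⁻¹ = thetaLoop i' j') : i = i' := by
  have := congrArg (labelHom (H := Multiplicative (Fin p → ℤ)) 1
    (fun i => Multiplicative.ofAdd (Pi.single i 1)) 1) h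
  rw [map_mul, map_mul, map_inv, mul_inv_cancel_comm, labelHom_thetaLoop, labelHom_thetaLoop,
    ← ofAdd_neg, ← ofAdd_neg, ← ofAdd_add, ← ofAdd_add] at this
  have := congrFun (Multiplicative.ofAdd.injective this) i
  by_contra hne
  simp only [Pi.add_apply, Pi.neg_apply, Pi.single_apply, hij, hne, if_true, if_false] at this
  split_ifs at this <;> omega

theorem permAut_injective (p k : ℕ) (hp : 2 ≤ p) : Function.Injective (permAut p k) := by
  intro σ τ h
  ext i
  have : Nontrivial (Fin p) := Fin.nontrivial_iff_two_le.2 hp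
  obtain ⟨j, hj⟩ := exists_ne i
  have h' := DFunLike.congr_fun h (thetaLoop i j)
  rw [permAut_thetaLoop, permAut_thetaLoop] at h'
  exact congrArg Fin.val (eq_of_isConj_thetaLoop (g := 1) (σ.injective.ne hj.symm) (by simpa))

end ThetaRose

/-! ### The rotations act simply transitively on the theta edges. -/

theorem mul_comm_of_mem_cyclicRotations {p : ℕ} (c d : cyclicRotations p) : c * d = d * c :=
  have : IsMulCommutative (cyclicRotations p) := by
    rw [cyclicRotations]
    infer_instance
  mul_comm' c d

theorem exists_cyclicRotations_apply_eq {p : ℕ} (hp : 2 ≤ p) (i j : Fin p) :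
    ∃ c : cyclicRotations p, c.1 i = j := by
  obtain ⟨n, hn⟩ : ∃ n : ℕ, p = n + 2 := ⟨p - 2, by omega⟩
  subst hn
  have hmem : ∀ i : Fin (n + 2), finRotate (n + 2) i ≠ i := fun i =>
    Equiv.Perm.mem_support.1 (by rw [support_finRotate]; exact Finset.mem_univ i)
  obtain ⟨m, hm⟩ := isCycle_finRotate.exists_zpow_eq (hmem i) (hmem j)
  exact ⟨⟨finRotate (n + 2) ^ m, ⟨m, rfl⟩⟩, hm⟩

/-- A transitive faithful action of an abelian group is free. -/
theorem cyclicRotations_eq_of_apply_eq {p : ℕ} (hp : 2 ≤ p) {c d : cyclicRotations p} {i : Fin p}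
    (h : c.1 i = d.1 i) : c = d := by
  refine Subtype.ext (Equiv.ext fun j => ?_)
  obtain ⟨e, rfl⟩ := exists_cyclicRotations_apply_eq hp i j
  have hc := DFunLike.congr_fun (congrArg Subtype.val (mul_comm_of_mem_cyclicRotations c e)) i
  have hd := DFunLike.congr_fun (congrArg Subtype.val (mul_comm_of_mem_cyclicRotations d e)) i
  simp only [Subgroup.coe_mul, Equiv.Perm.mul_apply] at hc hd
  rw [hc, hd, h]

/-! ### The quotient graph of groups as a semidirect product. -/

namespace ThetaRose

open Monoid

/-- The numbers of loops at the two vertices. -/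
abbrev roseRank (p k : ℕ) : Bool → ℕ
  | false => k
  | true => p - 1 - k

/-- The fundamental group of the quotient graph of groups: a free product of two factors, each of
which is the product of the free group on the loops at a vertex with the group of rotations. -/
abbrev OrbifoldGroup (p k : ℕ) : Type :=
  CoprodI fun i => FreeGroup (Fin (roseRank p k i)) × cyclicRotations p

variable {p k : ℕ}

/-- The copy of the free group on the loops at the basepoint. -/
def baseLoops (p k : ℕ) : FreeGroup (Fin k) →* OrbifoldGroup p k :=
  (CoprodI.of (M := fun i => FreeGroup (Fin (roseRank p k i)) × cyclicRotations p)
    (i := false)).comp (MonoidHom.inl _ _)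

/-- The copy of the free group on the loops at the other vertex. -/
def farLoops (p k : ℕ) : FreeGroup (Fin (p - 1 - k)) →* OrbifoldGroup p k :=
  (CoprodI.of (M := fun i => FreeGroup (Fin (roseRank p k i)) × cyclicRotations p)
    (i := true)).comp (MonoidHom.inl _ _)

/-- The stabilizer of the basepoint. -/
def baseRot (p k : ℕ) : cyclicRotations p →* OrbifoldGroup p k :=
  (CoprodI.of (M := fun i => FreeGroup (Fin (roseRank p k i)) × cyclicRotations p)
    (i := false)).comp (MonoidHom.inr _ _)

/-- The stabilizer of the other vertex. -/
def farRot (p k : ℕ) : cyclicRotations p →* OrbifoldGroup p k :=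
  (CoprodI.of (M := fun i => FreeGroup (Fin (roseRank p k i)) × cyclicRotations p)
    (i := true)).comp (MonoidHom.inr _ _)

theorem baseLoops_mul_baseRot (x : FreeGroup (Fin k)) (c : cyclicRotations p) :
    baseLoops p k x * baseRot p k c = CoprodI.of
      (M := fun i => FreeGroup (Fin (roseRank p k i)) × cyclicRotations p) (i := false) (x, c) := by
  simp only [baseLoops, baseRot, MonoidHom.comp_apply]
  rw [← map_mul]
  simp

theorem baseRot_mul_baseLoops (x : FreeGroup (Fin k)) (c : cyclicRotations p) :
    baseRot p k c * baseLoops p k x = baseLoops p k x * baseRot p k c := by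
  rw [baseLoops_mul_baseRot]
  simp only [baseLoops, baseRot, MonoidHom.comp_apply]
  rw [← map_mul]
  simp

theorem farLoops_mul_farRot (x : FreeGroup (Fin (p - 1 - k))) (c : cyclicRotations p) :
    farLoops p k x * farRot p k c = CoprodI.of
      (M := fun i => FreeGroup (Fin (roseRank p k i)) × cyclicRotations p) (i := true) (x, c) := by
  simp only [farLoops, farRot, MonoidHom.comp_apply]
  rw [← map_mul]
  simp

theorem farRot_mul_farLoops (x : FreeGroup (Fin (p - 1 - k))) (c : cyclicRotations p) :
    farRot p k c * farLoops p k x = farLoops p k x * farRot p k c := by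
  rw [farLoops_mul_farRot]
  simp only [farLoops, farRot, MonoidHom.comp_apply]
  rw [← map_mul]
  simp

theorem orbifoldGroup_hom_ext {H : Type*} [Monoid H] {f g : OrbifoldGroup p k →* H}
    (h1 : ∀ x, f (baseLoops p k x) = g (baseLoops p k x))
    (h2 : ∀ x, f (farLoops p k x) = g (farLoops p k x))
    (h3 : ∀ c, f (baseRot p k c) = g (baseRot p k c))
    (h4 : ∀ c, f (farRot p k c) = g (farRot p k c)) : f = g := by
  refine CoprodI.ext_hom _ _ fun i => MonoidHom.ext fun ⟨x, c⟩ => ?_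
  cases i with
  | false =>
    refine (congrArg f (baseLoops_mul_baseRot x c).symm).trans
      (Eq.trans ?_ (congrArg g (baseLoops_mul_baseRot x c)))
    rw [map_mul, map_mul, h1, h3]
  | true =>
    refine (congrArg f (farLoops_mul_farRot x c).symm).trans
      (Eq.trans ?_ (congrArg g (farLoops_mul_farRot x c)))
    rw [map_mul, map_mul, h2, h4]

/-- The action of the rotations on the fundamental group. -/
abbrev rotAut (p k : ℕ) : cyclicRotations p →* MulAut (PiOne p k) :=
  (permAut p k).comp (cyclicRotations p).subtype

section

variable (hp : 2 ≤ p) (i₀ : Fin p)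

/-- The rotation that carries the edge `i₀` to the edge `i`. -/
noncomputable def rotTo (i : Fin p) : cyclicRotations p :=
  (exists_cyclicRotations_apply_eq hp i₀ i).choose

theorem rotTo_apply (i : Fin p) : (rotTo hp i₀ i).1 i₀ = i :=
  (exists_cyclicRotations_apply_eq hp i₀ i).choose_spec

theorem rotTo_perm (c : cyclicRotations p) (i : Fin p) :
    rotTo hp i₀ (c.1 i) = c * rotTo hp i₀ i := by
  apply cyclicRotations_eq_of_apply_eq hp (i := i₀)
  rw [rotTo_apply, Subgroup.coe_mul, Equiv.Perm.mul_apply, rotTo_apply]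

theorem rotTo_self : rotTo hp i₀ i₀ = 1 := by
  apply cyclicRotations_eq_of_apply_eq hp (i := i₀)
  rw [rotTo_apply]
  rfl

theorem rotTo_perm_self (c : cyclicRotations p) : rotTo hp i₀ (c.1 i₀) = c := by
  rw [rotTo_perm, rotTo_self, mul_one]

/-- The embedding of the fundamental group of the graph into that of the quotient. -/
noncomputable def toOrbifoldGroup : PiOne p k →* OrbifoldGroup p k :=
  labelHom (fun i => baseLoops p k (FreeGroup.of i))
    -- The rotation from `i₀` to `i` about the basepoint, times the inverse of that rotation about
    -- the other vertex, is the loop `thetaLoop i i₀` in the semidirect product.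
    (fun i => baseRot p k (rotTo hp i₀ i) * (farRot p k (rotTo hp i₀ i))⁻¹)
    (fun i => farLoops p k (FreeGroup.of i))

theorem toOrbifoldGroup_leftHom (x : FreeGroup (Fin k)) :
    toOrbifoldGroup hp i₀ (leftHom p k x) = baseLoops p k x := by
  rw [toOrbifoldGroup, labelHom_leftHom]
  have h : FreeGroup.lift (fun i => baseLoops p k (FreeGroup.of i)) = baseLoops p k := by
    ext i
    simp
  rw [h]

theorem toOrbifoldGroup_thetaLoop (i j : Fin p) :
    toOrbifoldGroup hp i₀ (thetaLoop i j : PiOne p k) =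
      baseRot p k (rotTo hp i₀ i) * (farRot p k (rotTo hp i₀ i))⁻¹ *
        (farRot p k (rotTo hp i₀ j) * (baseRot p k (rotTo hp i₀ j))⁻¹) := by
  rw [toOrbifoldGroup, labelHom_thetaLoop, mul_inv_rev, inv_inv]

theorem toOrbifoldGroup_rightLoops (i : Fin p) (x : FreeGroup (Fin (p - 1 - k))) :
    toOrbifoldGroup hp i₀ (rightLoops i x : PiOne p k) =
      baseRot p k (rotTo hp i₀ i) * farLoops p k x * (baseRot p k (rotTo hp i₀ i))⁻¹ := by
  rw [toOrbifoldGroup, labelHom_rightLoops]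
  have h : FreeGroup.lift (fun i => farLoops p k (FreeGroup.of i)) = farLoops p k := by
    ext i
    simp
  have h' : (farRot p k (rotTo hp i₀ i))⁻¹ * farLoops p k x =
      farLoops p k x * (farRot p k (rotTo hp i₀ i))⁻¹ := by
    rw [← map_inv, farRot_mul_farLoops]
  rw [h, mul_assoc (baseRot p k (rotTo hp i₀ i)), h', mul_inv_rev, inv_inv]
  group

/-- This equivariance is what extends the embedding to the semidirect product. -/
theorem toOrbifoldGroup_permAut (c : cyclicRotations p) (x : PiOne p k) :
    toOrbifoldGroup hp i₀ (permAut p k c.1 x) =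
      baseRot p k c * toOrbifoldGroup hp i₀ x * (baseRot p k c)⁻¹ := by
  have h : (toOrbifoldGroup hp i₀).comp (permAut p k c.1).toMonoidHom =
      (MulAut.conj (baseRot p k c)).toMonoidHom.comp (toOrbifoldGroup hp i₀) := by
    refine hom_ext i₀ (fun x => ?_) (fun j => ?_) fun x => ?_
    · simp only [MonoidHom.comp_apply, MulEquiv.toMonoidHom_eq_coe, MonoidHom.coe_coe,
        MulAut.conj_apply, permAut_leftHom, toOrbifoldGroup_leftHom]
      rw [baseRot_mul_baseLoops, mul_inv_cancel_right]
    · simp only [MonoidHom.comp_apply, MulEquiv.toMonoidHom_eq_coe, MonoidHom.coe_coe,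
        MulAut.conj_apply, permAut_thetaLoop, toOrbifoldGroup_thetaLoop, rotTo_perm, map_mul]
      simp only [mul_inv_rev, mul_assoc]
      group
    · simp only [MonoidHom.comp_apply, MulEquiv.toMonoidHom_eq_coe, MonoidHom.coe_coe,
        MulAut.conj_apply, permAut_rightLoops, toOrbifoldGroup_rightLoops, rotTo_perm, map_mul]
      group
  exact DFunLike.congr_fun h x

/-- The map from the semidirect product with the rotations to the fundamental group of the
quotient. -/
noncomputable def ofSemidirect : PiOne p k ⋊[rotAut p k] cyclicRotations p →* OrbifoldGroup p k :=
  SemidirectProduct.lift (toOrbifoldGroup hp i₀) (baseRot p k) fun c =>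
    MonoidHom.ext fun x => toOrbifoldGroup_permAut hp i₀ c x

theorem ofSemidirect_inl (x : PiOne p k) :
    ofSemidirect hp i₀ (SemidirectProduct.inl x) = toOrbifoldGroup hp i₀ x :=
  SemidirectProduct.lift_inl ..

theorem ofSemidirect_inr (c : cyclicRotations p) :
    ofSemidirect (k := k) hp i₀ (SemidirectProduct.inr c) = baseRot p k c :=
  SemidirectProduct.lift_inr ..

/-- The rotations as a group of deck transformations that fixes a lift of the other vertex. -/
def farSection (k : ℕ) : cyclicRotations p →* PiOne p k ⋊[rotAut p k] cyclicRotations p where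
  toFun c := ⟨thetaLoop i₀ (c.1 i₀), c⟩
  map_one' := by
    ext
    · exact thetaLoop_self i₀
    · rfl
  map_mul' c d := by
    ext
    · change thetaLoop i₀ (c.1 (d.1 i₀)) =
        thetaLoop i₀ (c.1 i₀) * permAut p k c.1 (thetaLoop i₀ (d.1 i₀))
      rw [permAut_thetaLoop, thetaLoop_mul]
    · rfl

/-- The map from the fundamental group of the quotient to the semidirect product with the
rotations. -/
def toSemidirect : OrbifoldGroup p k →* PiOne p k ⋊[rotAut p k] cyclicRotations p :=
  CoprodI.lift fun i => match i with
    | false => MonoidHom.noncommCoprod (SemidirectProduct.inl.comp (leftHom p k))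
        SemidirectProduct.inr fun x c => by
          refine SemidirectProduct.ext ?_ ?_
          · change leftHom p k x * permAut p k 1 1 = 1 * permAut p k c.1 (leftHom p k x)
            rw [permAut_leftHom, map_one, one_mul, mul_one]
          · change 1 * c = c * 1
            rw [one_mul, mul_one]
    | true => MonoidHom.noncommCoprod (SemidirectProduct.inl.comp (rightLoops i₀))
        (farSection i₀ k) fun x c => by
          refine SemidirectProduct.ext ?_ ?_
          · change rightLoops i₀ x * permAut p k 1 (thetaLoop i₀ (c.1 i₀)) =
              thetaLoop i₀ (c.1 i₀) * permAut p k c.1 (rightLoops i₀ x)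
            rw [permAut_rightLoops, map_one, MulAut.one_apply,
              rightLoops_eq i₀ (c.1 i₀), inv_mul_cancel_right]
          · change 1 * c = c * 1
            rw [one_mul, mul_one]

theorem toSemidirect_baseLoops (x : FreeGroup (Fin k)) :
    toSemidirect i₀ (baseLoops p k x) = SemidirectProduct.inl (leftHom p k x) := by
  rw [toSemidirect, baseLoops, MonoidHom.comp_apply, CoprodI.lift_of]
  exact mul_one _

theorem toSemidirect_farLoops (x : FreeGroup (Fin (p - 1 - k))) :
    toSemidirect i₀ (farLoops p k x) = SemidirectProduct.inl (rightLoops i₀ x) := by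
  rw [toSemidirect, farLoops, MonoidHom.comp_apply, CoprodI.lift_of]
  refine (MonoidHom.noncommCoprod_apply ..).trans ?_
  simp only [MonoidHom.inl_apply, map_one, mul_one]
  rfl

theorem toSemidirect_baseRot (c : cyclicRotations p) :
    toSemidirect i₀ (baseRot p k c) = SemidirectProduct.inr c := by
  rw [toSemidirect, baseRot, MonoidHom.comp_apply, CoprodI.lift_of]
  refine (MonoidHom.noncommCoprod_apply ..).trans ?_
  simp only [MonoidHom.inr_apply, map_one, one_mul]

theorem toSemidirect_farRot (c : cyclicRotations p) :
    toSemidirect i₀ (farRot p k c) = farSection i₀ k c := by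
  rw [toSemidirect, farRot, MonoidHom.comp_apply, CoprodI.lift_of]
  refine (MonoidHom.noncommCoprod_apply ..).trans ?_
  simp only [MonoidHom.inr_apply, map_one, one_mul]

theorem farSection_apply (c : cyclicRotations p) :
    farSection i₀ k c =
      SemidirectProduct.inl (thetaLoop i₀ (c.1 i₀)) * SemidirectProduct.inr c :=
  (SemidirectProduct.mk_eq_inl_mul_inr ..)

/-- The two copies of a rotation differ by a theta loop; this expresses theta loops through
rotations and conversely. -/
theorem farRot_eq (c : cyclicRotations p) :
    farRot p k c = toOrbifoldGroup hp i₀ (thetaLoop i₀ (c.1 i₀)) * baseRot p k c := by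
  rw [toOrbifoldGroup_thetaLoop, rotTo_perm_self, rotTo_self]
  simp

/-- The fundamental group of the quotient graph of groups is the semidirect product of the
fundamental group of the graph with the rotations. -/
noncomputable def semidirectEquiv :
    PiOne p k ⋊[rotAut p k] cyclicRotations p ≃* OrbifoldGroup p k :=
  MonoidHom.toMulEquiv (ofSemidirect hp i₀) (toSemidirect i₀)
    (by
      refine SemidirectProduct.hom_ext (hom_ext i₀ (fun x => ?_) (fun j => ?_) fun x => ?_)
        (MonoidHom.ext fun c => ?_) <;>
      simp only [MonoidHom.comp_apply, ofSemidirect_inl, ofSemidirect_inr, MonoidHom.id_apply]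
      · rw [toOrbifoldGroup_leftHom, toSemidirect_baseLoops]
      · obtain ⟨c, rfl⟩ := exists_cyclicRotations_apply_eq hp i₀ j
        rw [← thetaLoop_inv, map_inv, map_inv, map_inv,
          eq_mul_inv_of_mul_eq (farRot_eq hp i₀ c).symm,
          map_mul, map_inv, toSemidirect_farRot, toSemidirect_baseRot, farSection_apply,
          mul_inv_cancel_right]
      · rw [toOrbifoldGroup_rightLoops, rotTo_self, map_one, one_mul, inv_one, mul_one,
          toSemidirect_farLoops]
      · rw [toSemidirect_baseRot])
    (by
      refine orbifoldGroup_hom_ext (fun x => ?_) (fun x => ?_) (fun c => ?_) fun c => ?_ <;>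
      rw [MonoidHom.comp_apply, MonoidHom.id_apply]
      · rw [toSemidirect_baseLoops, ofSemidirect_inl, toOrbifoldGroup_leftHom]
      · rw [toSemidirect_farLoops, ofSemidirect_inl, toOrbifoldGroup_rightLoops, rotTo_self,
          map_one, one_mul, inv_one, mul_one]
      · rw [toSemidirect_baseRot, ofSemidirect_inr]
      · rw [toSemidirect_farRot, farSection_apply, map_mul, ofSemidirect_inl, ofSemidirect_inr,
          ← farRot_eq])

theorem toOrbifoldGroup_injective :
    Function.Injective (toOrbifoldGroup hp i₀ : PiOne p k →* OrbifoldGroup p k) := fun x y h =>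
  SemidirectProduct.inl_injective ((semidirectEquiv hp i₀).injective
    (by
      change ofSemidirect hp i₀ _ = ofSemidirect hp i₀ _
      rw [ofSemidirect_inl, ofSemidirect_inl, h]))

end

end ThetaRose

/-! ### Faithfulness of the symmetries and the centralizer of the rotations. -/

namespace ThetaRose

open Monoid

variable {p k : ℕ} (hp : 2 ≤ p) (i₀ : Fin p)

/-- Malnormality puts `w` into the second factor, which the projection to `F_k` kills. -/
theorem eq_one_of_baseLoops_conj_farRot {w : FreeGroup (Fin k)} {c : cyclicRotations p}
    (hc : c ≠ 1) (h : baseLoops p k w * farRot p k c * (baseLoops p k w)⁻¹ = farRot p k c) :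
    w = 1 := by
  have hc' : ((1, c) : FreeGroup (Fin (roseRank p k true)) × cyclicRotations p) ≠ 1 := fun h =>
    hc (congrArg Prod.snd h)
  obtain ⟨a, ha⟩ := CoprodI.mem_range_of_of_conj
    (G := fun i => FreeGroup (Fin (roseRank p k i)) × cyclicRotations p) hc' h
  have key := congrArg (CoprodI.lift
    (M := fun i => FreeGroup (Fin (roseRank p k i)) × cyclicRotations p) fun i => match i with
    | false => MonoidHom.fst (FreeGroup (Fin k)) (cyclicRotations p)
    | true => 1) ha
  rw [CoprodI.lift_of, baseLoops, MonoidHom.comp_apply, CoprodI.lift_of] at key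
  exact key

include hp i₀ in
theorem exists_cyclicRotations_ne_one : ∃ c : cyclicRotations p, c ≠ 1 := by
  have : Nontrivial (Fin p) := Fin.nontrivial_iff_two_le.2 hp
  obtain ⟨j, hj⟩ := exists_ne i₀
  obtain ⟨c, rfl⟩ := exists_cyclicRotations_apply_eq hp i₀ j
  exact ⟨c, by rintro rfl; exact hj rfl⟩

theorem toOrbifoldGroup_thetaLoop_perm (c : cyclicRotations p) :
    toOrbifoldGroup hp i₀ (thetaLoop i₀ (c.1 i₀) : PiOne p k) =
      farRot p k c * (baseRot p k c)⁻¹ :=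
  eq_mul_inv_of_mul_eq (farRot_eq hp i₀ c).symm

include hp in
theorem symmetryAut_injective :
    Function.Injective (symmetryAut i₀ : Symmetry p k →* MulAut (PiOne p k)) := by
  rw [injective_iff_map_eq_one]
  rintro ⟨ν, ⟨w, β⟩, γ⟩ h
  have hl := fun x => DFunLike.congr_fun h (leftHom p k x)
  have ht := fun i j => DFunLike.congr_fun h (thetaLoop i j)
  have hr := fun x => DFunLike.congr_fun h (rightLoops i₀ x)
  simp only [symmetryAut_leftHom, symmetryAut_thetaLoop, symmetryAut_rightLoops,
    MulAut.one_apply] at hl ht hr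
  obtain rfl : ν = 1 := by
    ext i
    have : Nontrivial (Fin p) := Fin.nontrivial_iff_two_le.2 hp
    obtain ⟨j, hj⟩ := exists_ne i
    exact congrArg Fin.val (eq_of_isConj_thetaLoop (ν.injective.ne hj.symm)
      (g := (leftHom p k w)⁻¹) (by rw [inv_inv]; exact ht i j))
  obtain rfl : β = 1 := MulEquiv.ext fun x => leftHom_injective p k (hl x)
  obtain ⟨c, hc⟩ := exists_cyclicRotations_ne_one hp i₀
  -- The image of a theta loop is a far rotation times the inverse base rotation. The latter
  -- commutes with base loops, so `w⁻¹` centralizes the far rotation.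
  obtain rfl : w = 1 := by
    refine inv_eq_one.1 (eq_one_of_baseLoops_conj_farRot hc ?_)
    have h1 := congrArg (toOrbifoldGroup hp i₀) (ht i₀ (c.1 i₀))
    simp only [Equiv.Perm.one_apply] at h1
    rw [map_mul, map_mul, map_inv, toOrbifoldGroup_leftHom,
      toOrbifoldGroup_thetaLoop_perm] at h1
    have h2 := baseRot_mul_baseLoops w c
    have h3 : (baseRot p k c)⁻¹ * baseLoops p k w = baseLoops p k w * (baseRot p k c)⁻¹ := by
      rw [inv_mul_eq_iff_eq_mul, ← mul_assoc, h2, mul_inv_cancel_right]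
    rw [mul_assoc, mul_assoc, h3, ← mul_assoc, ← mul_assoc, mul_left_inj] at h1
    rw [map_inv, inv_inv, h1]
  obtain rfl : γ = 1 := MulEquiv.ext fun x => rightLoops_injective (k := k) i₀ (by
    have := hr x
    simp only [map_one, inv_one, one_mul, mul_one, Equiv.Perm.one_apply] at this
    exact this)
  rfl

include hp in
/-- The automorphisms of the fundamental group that commute with the rotations. -/
theorem exists_symmetryAut_eq_of_commute {φ : MulAut (PiOne p k)}
    (hφ : ∀ c : cyclicRotations p, φ * permAut p k c.1 = permAut p k c.1 * φ) :
    ∃ (c : cyclicRotations p) (s : _), φ = symmetryAut i₀ ((c.1, s) : Symmetry p k) := by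
  let φ' : MulAut (PiOne p k ⋊[rotAut p k] cyclicRotations p) :=
    SemidirectProduct.congr φ (MulEquiv.refl _) (by
      intro c
      ext x
      exact DFunLike.congr_fun (hφ c) x)
  let ψ : MulAut (OrbifoldGroup p k) :=
    ((semidirectEquiv hp i₀).symm.trans φ').trans (semidirectEquiv hp i₀)
  have hψ : ∀ x, ψ (ofSemidirect hp i₀ x) = ofSemidirect hp i₀ (φ' x) := fun x =>
    congrArg (fun y => semidirectEquiv hp i₀ (φ' y)) ((semidirectEquiv hp i₀).symm_apply_apply x)
  have hψ₁ : ∀ x, ψ (toOrbifoldGroup hp i₀ x) = toOrbifoldGroup hp i₀ (φ x) := fun x => by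
    rw [← ofSemidirect_inl, hψ, ← ofSemidirect_inl]
    congr 1
  have hψ₂ : ∀ c, ψ (baseRot p k c) = baseRot p k c := fun c => by
    rw [← ofSemidirect_inr hp i₀, hψ]
    congr 1
    exact SemidirectProduct.ext (map_one φ) rfl
  have hψ₃ : ∀ x, ψ (baseLoops p k x) = toOrbifoldGroup hp i₀ (φ (leftHom p k x)) := fun x => by
    rw [← hψ₁, toOrbifoldGroup_leftHom]
  have hψ₄ : ∀ x, ψ (farLoops p k x) = toOrbifoldGroup hp i₀ (φ (rightLoops i₀ x)) := fun x => by
    rw [← hψ₁, toOrbifoldGroup_rightLoops, rotTo_self, map_one, one_mul, inv_one, mul_one]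
  -- The map to `C` is the projection of the semidirect product, which `φ'` preserves.
  have hover : ∀ x, CoprodI.toCentral (fun i => FreeGroup (Fin (roseRank p k i)))
      (cyclicRotations p) (ψ x) = CoprodI.toCentral _ _ x := by
    have h1 : (CoprodI.toCentral (fun i => FreeGroup (Fin (roseRank p k i)))
        (cyclicRotations p)).comp (ofSemidirect hp i₀) = SemidirectProduct.rightHom := by
      refine SemidirectProduct.hom_ext (hom_ext i₀ (fun x => ?_) (fun j => ?_) fun x => ?_)
        (MonoidHom.ext fun c => ?_) <;>
      simp only [MonoidHom.comp_apply, ofSemidirect_inl, ofSemidirect_inr,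
        SemidirectProduct.rightHom_inl, SemidirectProduct.rightHom_inr]
      · rw [toOrbifoldGroup_leftHom]
        exact CoprodI.toCentral_of _
      · rw [toOrbifoldGroup_thetaLoop]
        have h2 : ∀ c, CoprodI.toCentral (fun i => FreeGroup (Fin (roseRank p k i)))
          (cyclicRotations p) (baseRot p k c) = c := fun c => CoprodI.toCentral_of _
        have h3 : ∀ c, CoprodI.toCentral (fun i => FreeGroup (Fin (roseRank p k i)))
          (cyclicRotations p) (farRot p k c) = c := fun c => CoprodI.toCentral_of _
        simp only [map_mul, map_inv, h2, h3, mul_inv_cancel, mul_one]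
      · rw [toOrbifoldGroup_rightLoops, rotTo_self, map_one, one_mul, inv_one, mul_one]
        exact CoprodI.toCentral_of _
      · exact CoprodI.toCentral_of _
    intro x
    obtain ⟨y, rfl⟩ := (semidirectEquiv hp i₀).surjective x
    refine (congrArg _ (hψ y)).trans ?_
    exact (DFunLike.congr_fun h1 (φ' y)).trans (DFunLike.congr_fun h1 y).symm
  obtain ⟨c₁, hc₁⟩ := exists_cyclicRotations_ne_one hp i₀
  obtain ⟨β, ⟨w, c⟩, hβ₀, hβ₁, ha⟩ := CoprodI.exists_of_map_of_false
    mul_comm_of_mem_cyclicRotations hc₁ hover (hψ₂ c₁)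
  rw [← baseLoops_mul_baseRot] at hβ₁ ha
  change ∀ x, ψ (baseLoops p k x) = baseLoops p k (β false x) at hβ₀
  change ∀ x, ψ (farLoops p k x) = baseLoops p k w * baseRot p k c * farLoops p k (β true x) *
    (baseLoops p k w * baseRot p k c)⁻¹ at hβ₁
  change ∀ d, ψ (farRot p k d) = baseLoops p k w * baseRot p k c * farRot p k d *
    (baseLoops p k w * baseRot p k c)⁻¹ at ha
  -- Conjugation by `baseRot p k c` is the rotation `c`. The inverse of `w` appears because
  -- symmetries conjugate by the inverse of their `F_k`-component.
  refine ⟨c, ⟨⟨w⁻¹, β false⟩, β true⟩, mulAut_ext i₀ (fun x => ?_) (fun j => ?_) fun x => ?_⟩ <;>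
  apply toOrbifoldGroup_injective hp i₀
  · rw [← hψ₃, hβ₀, symmetryAut_leftHom, toOrbifoldGroup_leftHom]
  · obtain ⟨d, rfl⟩ := exists_cyclicRotations_apply_eq hp i₀ j
    rw [← thetaLoop_inv, map_inv, map_inv, map_inv, map_inv, inv_inj, ← hψ₁,
      toOrbifoldGroup_thetaLoop_perm, map_mul, map_inv, hψ₂, ha, symmetryAut_thetaLoop,
      ← permAut_thetaLoop, map_mul, map_mul, map_inv, toOrbifoldGroup_permAut,
      toOrbifoldGroup_leftHom, toOrbifoldGroup_thetaLoop_perm, map_inv, inv_inv]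
    have h1 : baseLoops p k w * baseRot p k c * baseRot p k d =
        baseRot p k d * (baseLoops p k w * baseRot p k c) := by
      rw [← mul_assoc, baseRot_mul_baseLoops, mul_assoc, mul_assoc, ← map_mul, ← map_mul,
        mul_comm_of_mem_cyclicRotations]
    have h2 : (baseLoops p k w * baseRot p k c)⁻¹ * (baseRot p k d)⁻¹ =
        (baseRot p k d)⁻¹ * (baseLoops p k w * baseRot p k c)⁻¹ := by
      rw [← mul_inv_rev, ← h1, mul_inv_rev]
    rw [mul_assoc, h2]
    group
  · rw [← hψ₄, hβ₁, symmetryAut_rightLoops, ← permAut_rightLoops, map_mul, map_mul, map_inv,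
      toOrbifoldGroup_permAut, toOrbifoldGroup_rightLoops, toOrbifoldGroup_leftHom, rotTo_self,
      map_one, map_inv]
    group

/-! ### From the centralizer to the normalizer. -/

variable (p k) in
/-- The part of `Symmetry p k` that normalizes the rotations. -/
abbrev NormalizingSymmetry : Type :=
  Subgroup.normalizer (cyclicRotations p : Set (Equiv.Perm (Fin p))) ×
    (FreeGroup (Fin k) ⋊[MonoidHom.id (MulAut (FreeGroup (Fin k)))] MulAut (FreeGroup (Fin k))) ×
    MulAut (FreeGroup (Fin (p - 1 - k)))

/-- The action of the symmetries that normalize the rotations. -/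
def normalizingAut : NormalizingSymmetry p k →* MulAut (PiOne p k) :=
  (symmetryAut i₀).comp (MonoidHom.prodMap (Subgroup.subtype _) (MonoidHom.id _))

theorem normalizingAut_injective (hp : 2 ≤ p) :
    Function.Injective (normalizingAut i₀ : NormalizingSymmetry p k →* _) :=
  (symmetryAut_injective hp i₀).comp
    (Function.Injective.prodMap Subtype.val_injective Function.injective_id)

theorem normalizingAut_conj (t : NormalizingSymmetry p k) (c : Equiv.Perm (Fin p)) :
    normalizingAut i₀ t * permAut p k c * (normalizingAut i₀ t)⁻¹ =
      permAut p k (t.1.1 * c * t.1.1⁻¹) := by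
  rw [mul_inv_eq_iff_eq_mul, ← symmetryAut_perm i₀, ← symmetryAut_perm i₀]
  change symmetryAut i₀ _ * _ = _ * symmetryAut i₀ _
  rw [← map_mul, ← map_mul]
  congr 1
  ext1 <;> simp

theorem normalizingAut_mem_normalizer (t : NormalizingSymmetry p k) :
    normalizingAut i₀ t ∈ Subgroup.normalizer
      ((cyclicRotations p).map (permAut p k) : Set (MulAut (PiOne p k))) := by
  have key : ∀ (t : NormalizingSymmetry p k), ∀ h ∈ (cyclicRotations p).map (permAut p k),
      normalizingAut i₀ t * h * (normalizingAut i₀ t)⁻¹ ∈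
        (cyclicRotations p).map (permAut p k) := by
    rintro t _ ⟨c, hc, rfl⟩
    rw [normalizingAut_conj]
    exact ⟨_, (Subgroup.mem_normalizer_iff.1 t.1.2 c).1 hc, rfl⟩
  refine Subgroup.mem_normalizer_iff.2 fun h => ⟨key t h, fun hh => ?_⟩
  have := key t⁻¹ _ hh
  simpa [mul_assoc] using this

/-- A power of the rotation that has the same order is conjugate to it by an element of the
normalizer. -/
theorem exists_normalizer_conj_eq (hp : p.Prime) {c : Equiv.Perm (Fin p)}
    (hc : c ∈ cyclicRotations p) (horder : orderOf c = orderOf (finRotate p)) :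
    ∃ ν ∈ Subgroup.normalizer (cyclicRotations p : Set (Equiv.Perm (Fin p))),
      ν * finRotate p * ν⁻¹ = c := by
  have hrot : (finRotate p).IsCycle := isCycle_finRotate_of_le hp.two_le
  have hcard : orderOf (finRotate p) = p := by
    rw [hrot.orderOf, support_finRotate_of_le hp.two_le]
    simp
  -- An element of prime order `p` in `Σ_p` is a `p`-cycle.
  have hcyc : c.IsCycle := Equiv.Perm.isCycle_of_prime_order'' (by simpa using hp)
    (by rw [horder, hcard]; simp)
  obtain ⟨ν, hν⟩ := isConj_iff.1 ((hrot.isConj_iff hcyc).2 (by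
    rw [← hrot.orderOf, ← hcyc.orderOf, horder]))
  refine ⟨ν, Subgroup.mem_normalizer_fintype ?_, hν⟩
  rintro _ ⟨n, rfl⟩
  simp only
  rw [← conj_zpow, hν]
  exact Subgroup.zpow_mem _ hc n

/-- A normalizing `φ` conjugates the generating rotation to a rotation of the same order, and so
does some `ν` normalizing `C` in `Σ_p`. Then `ν⁻¹ φ` centralizes the rotations. -/
theorem range_normalizingAut (hp : p.Prime) :
    (normalizingAut i₀ : NormalizingSymmetry p k →* _).range = Subgroup.normalizer
      ((cyclicRotations p).map (permAut p k) : Set (MulAut (PiOne p k))) := by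
  apply le_antisymm
  · rintro _ ⟨t, rfl⟩
    exact normalizingAut_mem_normalizer i₀ t
  intro φ hφ
  obtain ⟨c, hc, hcφ⟩ := (Subgroup.mem_normalizer_iff.1 hφ (permAut p k (finRotate p))).1
    ⟨_, Subgroup.mem_zpowers _, rfl⟩
  have hinj := permAut_injective p k hp.two_le
  have horder : orderOf c = orderOf (finRotate p) := by
    rw [← orderOf_injective _ hinj c, ← orderOf_injective _ hinj (finRotate p), hcφ,
      ← MulAut.conj_apply]
    exact MulEquiv.orderOf_eq _ _
  obtain ⟨ν, hν, rfl⟩ := exists_normalizer_conj_eq hp hc horder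
  have hcomm : Commute ((permAut p k ν)⁻¹ * φ) (permAut p k (finRotate p)) := by
    change _ * _ = _ * _
    rw [map_mul, map_mul, map_inv] at hcφ
    rw [mul_assoc, mul_inv_eq_iff_eq_mul.1 hcφ.symm]
    group
  obtain ⟨d, s, hs⟩ := exists_symmetryAut_eq_of_commute hp.two_le i₀
    (φ := (permAut p k ν)⁻¹ * φ) (by
      rintro ⟨_, n, rfl⟩
      simp only [map_zpow]
      exact (hcomm.zpow_right n).eq)
  refine ⟨(⟨ν, hν⟩ * ⟨d.1, Subgroup.le_normalizer d.2⟩, s), ?_⟩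
  change symmetryAut i₀ ((ν * d.1, s) : Symmetry p k) = φ
  have h : ((ν * d.1, s) : Symmetry p k) = (ν, 1) * (d.1, s) := by simp
  rw [h, map_mul, ← hs, symmetryAut_perm, mul_inv_cancel_left]

end ThetaRose

/-- In the semidirect product, `Aut(F_k)` acts on `F_k` in the tautological way. -/
theorem lemma5p7 (p : ℕ) (hp : p.Prime) (hp_odd : p ≠ 2) (k : ℕ) (hk : k ≤ p - 1) :
    Nonempty (FreeGroup (Fin (2 * (p - 1))) ≃* ThetaRose.PiOne p k) ∧
    ∀ η : FreeGroup (Fin (2 * (p - 1))) ≃* ThetaRose.PiOne p k,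
      Nonempty
        (Subgroup.normalizer (subgroupB p k η : Set (MulAut (FreeGroup (Fin (2 * (p - 1)))))) ≃*
          Subgroup.normalizer (cyclicRotations p : Set (Equiv.Perm (Fin p))) ×
          (FreeGroup (Fin k) ⋊[MonoidHom.id (MulAut (FreeGroup (Fin k)))]
            MulAut (FreeGroup (Fin k))) ×
          MulAut (FreeGroup (Fin (p - 1 - k)))) := by
  refine ⟨ThetaRose.nonempty_freeGroup_equiv hp.pos hk, fun η => ?_⟩
  let i₀ : Fin p := ⟨0, hp.pos⟩
  have h : Subgroup.normalizer (subgroupB p k η : Set (MulAut (FreeGroup (Fin (2 * (p - 1)))))) =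
      (Subgroup.normalizer ((cyclicRotations p).map (ThetaRose.permAut p k) :
        Set (MulAut (ThetaRose.PiOne p k)))).map (MulAut.congr η.symm).toMonoidHom :=
    (Subgroup.map_equiv_normalizer_eq _ (MulAut.congr η.symm)).symm
  exact ⟨(MulEquiv.subgroupCongr h).trans
    (((MulAut.congr η.symm).subgroupMap _).symm.trans
      ((MulEquiv.subgroupCongr (ThetaRose.range_normalizingAut i₀ hp).symm).trans
        (MonoidHom.ofInjective (ThetaRose.normalizingAut_injective i₀ hp.two_le)).symm))⟩
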